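/- Consider the $O(N)$ colored Grosse--Wulkenhaar model at $\Omega=1$ in the matrix basis, with mass parameter $\mu\in\mathbb{R}$, $A=2+\mu^2/4$, propagator $G_{mn}=(m_1+m_2+n_1+n_2+A)^{-1}$ for $m,n\in\mathbb{N}^2$ (diagonal in color, $C_{mn;kl}=G_{mn}\delta_{ml}\delta_{nk}$), and interaction $$V_1+V_2=\frac{\lambda_1}{2}\sum_{m,n,k,l}\phi^c_{mn}\phi^c_{nk}\phi^d_{kl}\phi^d_{lm}+\frac{\lambda_2}{4}\sum_{m,n,k,l}\phi^c_{mn}\phi^d_{nk}\phi^c_{kl}\phi^d_{lm},$$ with repeated colors summed from $1$ to $N$ and with matrix indices restricted to $\{0,\dots,\Lambda\}^2$ by an ultraviolet cutoff $\Lambda$. Each closed color loop gives a factor $N$, so that $N$ may be treated as a real parameter. Let $\Sigma(m,n)$ be the self-energy and let $\Gamma_{4,\parallel}(m,n,k,l)$, $\Gamma_{4,\times}(m,n,k,l)$ be the amputated one-particle irreducible four-point functions with external fields $\phi^a_{mn}\phi^a_{nk}\phi^b_{kl}\phi^b_{lm}$ and $\phi^a_{mn}\phi^b_{nk}\phi^a_{kl}\phi^b_{lm}$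 respectively (fixed external color threads $a$, $b$). They are formal power series in $(\lambda_1,\lambda_2)$, given by the sums over Wick contractions whose ribbon graphs are one-particle irreducible, of genus zero and with one broken external face. Put $Z=1-\partial_{m_1}\Sigma(m,n)|_{m=n=0}$ and $$\lambda_{1,r}=-\frac{\Gamma_{4,\parallel}(0,0,0,0)}{Z^2},\qquad \lambda_{2,r}=-\frac{\Gamma_{4,\times}(0,0,0,0)}{Z^2},\qquad S^{(1)}=\sum_{p\in\{0,\dots,\Lambda\}^2}\frac{1}{(p_1+p_2+A)^2}.$$ Then, for every $\Lambda$ and up to terms of total order at least three in $(\lambda_1,\lambda_2)$, $$\lambda_{1,r}=\lambda_1-\bigl(\lambda_1^2(1-N)+\lambda_2^2\bigr)S^{(1)},\qquad \lambda_{2,r}=\lambda_2+\bigl(2\lambda_2^2-2(1-N)\lambda_1\lambda_2\bigr)S^{(1)},$$ and $S^{(1)}$ diverges logarithmically when the cutoff is removed: $S^{(1)}\to\infty$ and $S^{(1)}=\log\Lambda+O(1)$ as $\Lambda\to\infty$. Consequently the one-loop $\beta$-coefficients, i.e. the coefficients of $-\lambda_1^2S^{(1)}$ in $\lambda_{1,r}$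 and of $-\lambda_2^2S^{(1)}$ in $\lambda_{2,r}$, are $\beta_\parallel=1-N$ and $\beta_\times=-2$. Let $\beta_i(\lambda)$ be the quadratic part of $-\lambda_{i,r}/S^{(1)}$, and let the one-loop flow of the bare couplings at fixed renormalized couplings be $d\lambda_i/ds=\beta_i(\lambda)$ in the scale $s=S^{(1)}$. On the line $\lambda_2=0$, with renormalized coupling $\lambda_1(s=0)=g>0$: if $N>1$ the model is asymptotically free (the bare coupling exists for all $s\ge 0$ and tends to $0$ as $s\to\infty$); if $N<1$ there is a Landau ghost (the bare coupling tends to $+\infty$ at a finite scale $s$); and the one-loop $\beta$-function vanishes on this line if and only if $N=1$. -/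

import Mathlib

open Filter Topology Asymptotics

noncomputable section

namespace ColorGW

/-! ### Propagator and cutoff -/

/-- Mass parameter `A = 2 + μ² / 4`. -/
def massA (μ : ℝ) : ℝ := 2 + μ ^ 2 / 4

/-- The propagator `G_{mn} = (m₁ + m₂ + n₁ + n₂ + A)⁻¹`, written for real index pairs, so that one can
differentiate with respect to an external index. -/
def propagator (μ : ℝ) (m n : ℝ × ℝ) : ℝ :=
  (m.1 + m.2 + n.1 + n.2 + massA μ)⁻¹

lemma propagator_comm (μ : ℝ) (m n : ℝ × ℝ) : propagator μ m n = propagator μ n m := by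
  unfold propagator
  congr 1
  ring

/-- With the ultraviolet cutoff `Λ`, matrix indices run over `{0, …, Λ}² ⊂ ℕ²`. -/
abbrev Box (Λ : ℕ) : Type := Fin (Λ + 1) × Fin (Λ + 1)

/-- The cut-off sum `S⁽¹⁾ = ∑_p 1 / (p + A)²`, with `p = p₁ + p₂` in the summand. -/
def S1 (μ : ℝ) (Λ : ℕ) : ℝ :=
  ∑ p : Box Λ, 1 / (((p.1 : ℕ) : ℝ) + ((p.2 : ℕ) : ℝ) + massA μ) ^ 2

/-! ### Wick contractions and ribbon graphs

A graph has `k` external fields `φ_{e₀e₁} φ_{e₁e₂} ⋯ φ_{e_{k-1}e₀}`, `n₁` parallel vertices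
`φ^c_{mn} φ^c_{nk} φ^d_{kl} φ^d_{lm}` and `n₂` crossed vertices `φ^c_{mn} φ^d_{nk} φ^c_{kl} φ^d_{lm}`. -/

/-- Vertices: `n₁` parallel ones (`Sum.inl`) and `n₂` crossed ones (`Sum.inr`). -/
abbrev Vertex (n₁ n₂ : ℕ) : Type := Fin n₁ ⊕ Fin n₂

/-- The fields: `k` external ones and four at each vertex. -/
abbrev Dart (k n₁ n₂ : ℕ) : Type := Fin k ⊕ (Vertex n₁ n₂ × Fin 4)

/-- The following field in the cyclic order of the trace in which a field stands. The field `d` is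
`φ_{x y}`, where `x` is the matrix index at `d` and `y` is the matrix index at `nextDart d`. -/
def nextDart (k n₁ n₂ : ℕ) : Equiv.Perm (Dart k n₁ n₂) :=
  Equiv.sumCongr (finRotate k) (Equiv.prodCongr (Equiv.refl _) (finRotate 4))

/-- Color pattern `a a b b` of four cyclically ordered fields. -/
def parallelMate : Equiv.Perm (Fin 4) := Equiv.swap 0 1 * Equiv.swap 2 3

/-- Color pattern `a b a b` of four cyclically ordered fields. -/
def crossedMate : Equiv.Perm (Fin 4) := Equiv.swap 0 2 * Equiv.swap 1 3

/-- The field at the same vertex that carries the same color (external fields are left alone). -/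
def colorMate {k n₁ n₂ : ℕ} : Dart k n₁ n₂ → Dart k n₁ n₂
  | Sum.inl i => Sum.inl i
  | Sum.inr (Sum.inl v, i) => Sum.inr (Sum.inl v, parallelMate i)
  | Sum.inr (Sum.inr v, i) => Sum.inr (Sum.inr v, crossedMate i)

section Graph

variable {k n₁ n₂ : ℕ} (σ : Equiv.Perm (Dart k n₁ n₂))

/-- `σ` pairs off all the fields, and every external field is paired with a field of a vertex. -/
def IsContraction : Prop :=
  (∀ d, σ (σ d) = d) ∧ (∀ d, σ d ≠ d) ∧ ∀ i : Fin k, ∃ h, σ (Sum.inl i) = Sum.inr h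

/-- The contraction of `φ_{mn}` with `φ_{kl}` is `G_{mn} δ_{ml} δ_{nk}`: the matrix index at `d` is
identified with the one at `nextDart (σ d)`. The orbits of this permutation are the faces. -/
def facePerm : Equiv.Perm (Dart k n₁ n₂) := σ.trans (nextDart k n₁ n₂)

/-- The number of faces (the product of external fields being counted as one more vertex). -/
def numFaces : ℕ := Nat.card (Quotient (Equiv.Perm.SameCycle.setoid (facePerm σ)))

/-- Two vertices joined by a propagator other than the one (if any) that contains a field of
`removed`. -/
def VertexAdj (removed : Set (Dart k n₁ n₂)) (v w : Vertex n₁ n₂) : Prop :=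
  ∃ i j : Fin 4, σ (Sum.inr (v, i)) = Sum.inr (w, j) ∧
    Sum.inr (v, i) ∉ removed ∧ Sum.inr (w, j) ∉ removed

/-- One-particle irreducible: connected, and still connected when any one internal propagator is
cut. (External propagators are amputated.) -/
def IsOnePI : Prop :=
  (∀ v w, Relation.ReflTransGen (VertexAdj σ ∅) v w) ∧
  ∀ h h' : Vertex n₁ n₂ × Fin 4, σ (Sum.inr h) = Sum.inr h' →
    ∀ v w, Relation.ReflTransGen (VertexAdj σ {Sum.inr h, Sum.inr h'}) v w

/-- Genus zero and a single broken face, along which the external fields stand in their cyclic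
order with pairwise independent matrix indices: with the product of external fields as an additional
vertex, the Euler characteristic `V - E + F` is `2`, and the external indices lie on distinct
faces. -/
def IsPlanarRegular : Prop :=
  2 * (n₁ + n₂ + 1) + 2 * numFaces σ = Fintype.card (Dart k n₁ n₂) + 4 ∧
  ∀ i j : Fin k, (facePerm σ).SameCycle (Sum.inl i) (Sum.inl j) → i = j

/-- Colors are transported along propagators and through vertices. -/
def colorSetoid : Setoid (Dart k n₁ n₂) :=
  Relation.EqvGen.setoid fun d d' => d' = σ d ∨ d' = colorMate d

/-- The color threads connect the external fields according to the given pattern. -/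
def ColorMatches (pattern : Equiv.Perm (Fin k)) : Prop :=
  ∀ i : Fin k, (colorSetoid σ).r (Sum.inl i) (Sum.inl (pattern i))

/-- The number of closed color loops, each of which yields a factor `N`. -/
def numColorLoops : ℕ :=
  Nat.card {q : Quotient (colorSetoid σ) // ∀ i : Fin k, q ≠ Quotient.mk _ (Sum.inl i)}

open Classical in
/-- The internal propagators. -/
def internalEdges : Finset (Sym2 (Dart k n₁ n₂)) :=
  (Finset.univ.filter fun d => d.isRight ∧ (σ d).isRight).image fun d => s(d, σ d)

/-- The value of a matrix index: the external index `e i`, or a summed index in the box. -/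
def indexValue {Λ : ℕ} (e : Fin k → ℝ × ℝ) : Fin k ⊕ Box Λ → ℝ × ℝ
  | Sum.inl i => e i
  | Sum.inr p => (((p.1 : ℕ) : ℝ), ((p.2 : ℕ) : ℝ))

open Classical in
/-- The assignments of matrix indices to the fields: constant on faces, equal to the external index
`i` on the face of the `i`-th external index, and a free index in the box on every other face. -/
def labelings (Λ : ℕ) : Finset (Dart k n₁ n₂ → Fin k ⊕ Box Λ) :=
  Finset.univ.filter fun x =>
    (∀ d, x (facePerm σ d) = x d) ∧ (∀ i : Fin k, x (Sum.inl i) = Sum.inl i) ∧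
    ∀ d, ∀ i : Fin k, x d = Sum.inl i → (facePerm σ).SameCycle d (Sum.inl i)

/-- The propagator of an edge `{d, d'}`; the index at `d'` is the second index of the field `d`. -/
def edgeValue (μ : ℝ) (y : Dart k n₁ n₂ → ℝ × ℝ) : Sym2 (Dart k n₁ n₂) → ℝ :=
  Sym2.lift ⟨fun d d' => propagator μ (y d) (y d'), fun _ _ => propagator_comm _ _ _⟩

/-- The amputated amplitude: the product of the internal propagators, summed over the indices of
the internal faces (no coupling constants, no color factor). -/
def amplitude (μ : ℝ) (Λ : ℕ) (e : Fin k → ℝ × ℝ) : ℝ :=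
  ∑ x ∈ labelings σ Λ, ∏ b ∈ internalEdges σ, edgeValue μ (fun d => indexValue e (x d)) b

end Graph

open Classical in
/-- The coefficient of `λ₁ ^ n₁ * λ₂ ^ n₂` in the amputated 1PI `k`-point function with the given
external color pattern: in the expansion of `exp (-V₁ - V₂)`, the sum over all Wick contractions
that give a planar regular 1PI graph, with the weights `-1/2` and `-1/4` of the vertices and a
factor `N` for each closed color loop. -/
def onePICoeff {k : ℕ} (pattern : Equiv.Perm (Fin k)) (μ N : ℝ) (Λ : ℕ) (e : Fin k → ℝ × ℝ)
    (n₁ n₂ : ℕ) : ℝ :=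
  ((-1 / 2 : ℝ) ^ n₁ / (n₁.factorial : ℝ)) * ((-1 / 4 : ℝ) ^ n₂ / (n₂.factorial : ℝ)) *
    ∑ σ ∈ Finset.univ.filter fun σ : Equiv.Perm (Dart k n₁ n₂) =>
        IsContraction σ ∧ IsOnePI σ ∧ IsPlanarRegular σ ∧ ColorMatches σ pattern,
      N ^ numColorLoops σ * amplitude σ μ Λ e

/-! ### Self-energy, wave function renormalization, renormalized couplings

Formal power series in `λ₁ = X 0` and `λ₂ = X 1`, at fixed cutoff. -/

/-- Coefficient of `λ₁ ^ n₁ * λ₂ ^ n₂` in the self-energy `Σ(m, n)`. -/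
def selfEnergyCoeff (μ N : ℝ) (Λ : ℕ) (m n : ℝ × ℝ) (n₁ n₂ : ℕ) : ℝ :=
  onePICoeff (Equiv.swap (0 : Fin 2) 1) μ N Λ ![m, n] n₁ n₂

/-- `∂Σ(m, n)/∂m₁` at `m = n = 0`. (Each coefficient of `Σ` is a rational function of `m₁` without
pole at `0`.) -/
def dSelfEnergy (μ N : ℝ) (Λ : ℕ) : MvPowerSeries (Fin 2) ℝ :=
  fun d => deriv (fun t : ℝ => selfEnergyCoeff μ N Λ (t, 0) (0, 0) (d 0) (d 1)) 0

/-- The wave function renormalization `Z = 1 - ∂Σ(m, n)/∂m₁` at `m = n = 0`. -/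
def waveZ (μ N : ℝ) (Λ : ℕ) : MvPowerSeries (Fin 2) ℝ := 1 - dSelfEnergy μ N Λ

/-- The amputated 1PI four-point function at vanishing external indices, for the external color
pattern `a a b b` (`i = 0`) or `a b a b` (`i = 1`). -/
def gammaFour (μ N : ℝ) (Λ : ℕ) (i : Fin 2) : MvPowerSeries (Fin 2) ℝ :=
  fun d => onePICoeff (![parallelMate, crossedMate] i) μ N Λ (fun _ => (0, 0)) (d 0) (d 1)

/-- The renormalized couplings `λ_{1,r}` (`i = 0`) and `λ_{2,r}` (`i = 1`):
`-Γ₄(0,0,0,0) / Z²`. The constant coefficient of `Z` is `1`. -/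
def lambdaR (μ N : ℝ) (Λ : ℕ) (i : Fin 2) : MvPowerSeries (Fin 2) ℝ :=
  -gammaFour μ N Λ i * (waveZ μ N Λ ^ 2)⁻¹

/-- Equality up to terms of total order at least three in the couplings. -/
def EqModCubic (f g : MvPowerSeries (Fin 2) ℝ) : Prop :=
  ∀ d : Fin 2 →₀ ℕ, d 0 + d 1 ≤ 2 → MvPowerSeries.coeff d f = MvPowerSeries.coeff d g

/-! ### One-loop β-functions and flow -/

/-- The coefficient of `λ₁ ^ a * λ₂ ^ b` in `-λ_{i,r} / S⁽¹⁾`. -/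
def flowCoeff (μ N : ℝ) (Λ : ℕ) (i : Fin 2) (a b : ℕ) : ℝ :=
  -MvPowerSeries.coeff (Finsupp.single 0 a + Finsupp.single 1 b) (lambdaR μ N Λ i) / S1 μ Λ

/-- `β_∥`: the coefficient of `-λ₁² S⁽¹⁾` in `λ_{1,r}`. -/
def betaParallel (μ N : ℝ) (Λ : ℕ) : ℝ := flowCoeff μ N Λ 0 2 0

/-- `β_×`: the coefficient of `-λ₂² S⁽¹⁾` in `λ_{2,r}`. -/
def betaCrossed (μ N : ℝ) (Λ : ℕ) : ℝ := flowCoeff μ N Λ 1 0 2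

/-- The one-loop β-function: `λ_{i,r} = λ_i - β_i(λ) S⁽¹⁾` up to third order. -/
def betaFunction (μ N : ℝ) (Λ : ℕ) (x : Fin 2 → ℝ) : Fin 2 → ℝ := fun i =>
  flowCoeff μ N Λ i 2 0 * x 0 ^ 2 + flowCoeff μ N Λ i 1 1 * (x 0 * x 1) +
    flowCoeff μ N Λ i 0 2 * x 1 ^ 2

/-- `x s` is the bare parallel coupling when `S⁽¹⁾ = s`, for the fixed renormalized coupling `g` and
vanishing crossed coupling: `(x, 0)` solves the one-loop flow equation `dλ/ds = β(λ)` on `I`. -/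
def IsParallelFlow (β : (Fin 2 → ℝ) → Fin 2 → ℝ) (g : ℝ) (I : Set ℝ) (x : ℝ → ℝ) : Prop :=
  x 0 = g ∧ ∀ s ∈ I, HasDerivWithinAt (fun t => ![x t, 0]) (β ![x s, 0]) I s

/-- Asymptotic freedom at `λ₂ = 0`: at fixed renormalized coupling, the bare coupling exists at all
scales and tends to zero when the cutoff is removed. -/
def AsymptoticallyFree (β : (Fin 2 → ℝ) → Fin 2 → ℝ) : Prop :=
  ∀ g : ℝ, 0 < g → (∃ x, IsParallelFlow β g (Set.Ici 0) x) ∧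
    ∀ x, IsParallelFlow β g (Set.Ici 0) x → Tendsto x atTop (𝓝 0)

/-- Landau ghost at `λ₂ = 0`: at fixed renormalized coupling, the bare coupling grows beyond all
bounds, already at a finite scale. -/
def HasLandauGhost (β : (Fin 2 → ℝ) → Fin 2 → ℝ) : Prop :=
  ∀ g : ℝ, 0 < g → ∃ T : ℝ, 0 < T ∧ (∃ x, IsParallelFlow β g (Set.Ico 0 T) x) ∧
    ∀ x, IsParallelFlow β g (Set.Ico 0 T) x → Tendsto x (𝓝[<] T) atTop

end ColorGW

end

/-! At total order at most two, counting faces leaves three planar one-particle irreducible ribbon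
graphs up to rotations of the vertices: a vertex with four external legs, the tadpole, and the
bubble of two vertices joined by two neighboring propagators. Every Wick contraction is a relabeling
of one of them by a cyclic shift of the external fields and a rotation of each vertex, and all
relabelings have the same amplitude up to the shift of the external indices. Hence each coefficient
is one amplitude times the number of relabelings whose color threads match the external pattern,
weighted by the closed loops and divided by the number of automorphisms of the graph.

The tadpole, differentiated in an external index, and the bubble, at vanishing external indices,
both produce `S⁽¹⁾`, so expanding `-Γ₄ / Z²` to second order gives the renormalized couplings. The
sum `S⁽¹⁾` is compared with a harmonic sum by telescoping. On the line `λ₂ = 0` the flow is the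
Riccati equation `x' = (1 - N) x²`, whose only solution is `g / (1 - (1 - N) g s)`. -/

noncomputable section

namespace ColorGW

section Relabel

variable {k n₁ n₂ m₁ m₂ l₁ l₂ : ℕ}

@[simp] lemma nextDart_inl [NeZero k] (i : Fin k) :
    nextDart k n₁ n₂ (Sum.inl i) = Sum.inl (i + 1) := by
  simp [nextDart]

@[simp] lemma nextDart_inr (v : Vertex n₁ n₂) (a : Fin 4) :
    nextDart k n₁ n₂ (Sum.inr (v, a)) = Sum.inr (v, a + 1) := by
  simp [nextDart]

lemma facePerm_apply (σ : Equiv.Perm (Dart k n₁ n₂)) (d : Dart k n₁ n₂) :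
    facePerm σ d = nextDart k n₁ n₂ (σ d) := rfl

lemma sameCycle_permCongr {α β : Type*} (e : α ≃ β) (f : Equiv.Perm α) (x y : α) :
    (e.permCongr f).SameCycle (e x) (e y) ↔ f.SameCycle x y := by
  have h (n : ℤ) : (e.permCongr f) ^ n = e.permCongr (f ^ n) :=
    (map_zpow e.permCongrHom f n).symm
  simp only [Equiv.Perm.SameCycle, h, Equiv.permCongr_apply, Equiv.symm_apply_apply,
    EmbeddingLike.apply_eq_iff_eq]

variable [NeZero k]

/-- Relabeling of the fields: a cyclic shift `s` of the external fields, a bijection `φ` of the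
vertices, and a rotation `ρ v` of the four fields of each vertex `v`. -/
def relabel (s : Fin k) (φ : Vertex n₁ n₂ ≃ Vertex m₁ m₂) (ρ : Vertex n₁ n₂ → Fin 4) :
    Dart k n₁ n₂ ≃ Dart k m₁ m₂ :=
  Equiv.sumCongr (Equiv.addRight s) (Equiv.prodShear φ fun v => Equiv.addRight (ρ v))

/-- The Wick contraction obtained from `σ` by transport along `relabel s φ ρ`. -/
def relabelGraph (s : Fin k) (φ : Vertex n₁ n₂ ≃ Vertex m₁ m₂) (ρ : Vertex n₁ n₂ → Fin 4)
    (σ : Equiv.Perm (Dart k n₁ n₂)) : Equiv.Perm (Dart k m₁ m₂) :=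
  (relabel s φ ρ).permCongr σ

variable (s : Fin k) (φ : Vertex n₁ n₂ ≃ Vertex m₁ m₂) (ρ : Vertex n₁ n₂ → Fin 4)

@[simp] lemma relabel_inl (i : Fin k) : relabel s φ ρ (Sum.inl i) = Sum.inl (i + s) := rfl

@[simp] lemma relabel_inr (v : Vertex n₁ n₂) (a : Fin 4) :
    relabel s φ ρ (Sum.inr (v, a)) = Sum.inr (φ v, a + ρ v) := rfl

lemma isRight_relabel (d : Dart k n₁ n₂) : (relabel s φ ρ d).isRight = d.isRight := by
  cases d <;> rfl

lemma exists_relabel_inr (h : Vertex m₁ m₂ × Fin 4) :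
    ∃ g : Vertex n₁ n₂ × Fin 4, relabel s φ ρ (Sum.inr g) = Sum.inr h :=
  ⟨(φ.symm h.1, h.2 - ρ (φ.symm h.1)), by simp⟩

lemma relabel_nextDart (d : Dart k n₁ n₂) :
    relabel s φ ρ (nextDart k n₁ n₂ d) = nextDart k m₁ m₂ (relabel s φ ρ d) := by
  rcases d with i | ⟨v, a⟩ <;> simp [add_right_comm]

variable (σ : Equiv.Perm (Dart k n₁ n₂))

@[simp] lemma relabelGraph_relabel (d : Dart k n₁ n₂) :
    relabelGraph s φ ρ σ (relabel s φ ρ d) = relabel s φ ρ (σ d) := by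
  simp [relabelGraph]

lemma relabelGraph_relabelGraph (t : Fin k) (ψ : Vertex m₁ m₂ ≃ Vertex l₁ l₂)
    (π : Vertex m₁ m₂ → Fin 4) :
    relabelGraph t ψ π (relabelGraph s φ ρ σ) =
      relabelGraph (s + t) (φ.trans ψ) (fun v => ρ v + π (φ v)) σ := by
  have h (d : Dart k n₁ n₂) : relabel (s + t) (φ.trans ψ) (fun v => ρ v + π (φ v)) d =
      relabel t ψ π (relabel s φ ρ d) := by
    rcases d with i | ⟨v, a⟩ <;> simp [add_assoc]
  ext1 d
  obtain ⟨d, rfl⟩ := (relabel t ψ π).surjective d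
  obtain ⟨d, rfl⟩ := (relabel s φ ρ).surjective d
  rw [relabelGraph_relabel, relabelGraph_relabel, ← h, ← h, relabelGraph_relabel]

lemma facePerm_relabelGraph :
    facePerm (relabelGraph s φ ρ σ) = (relabel s φ ρ).permCongr (facePerm σ) := by
  ext1 d
  obtain ⟨d, rfl⟩ := (relabel s φ ρ).surjective d
  rw [facePerm_apply, relabelGraph_relabel, Equiv.permCongr_apply, Equiv.symm_apply_apply,
    facePerm_apply, relabel_nextDart]

lemma sameCycle_facePerm_relabelGraph (d d' : Dart k n₁ n₂) :
    (facePerm (relabelGraph s φ ρ σ)).SameCycle (relabel s φ ρ d) (relabel s φ ρ d') ↔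
      (facePerm σ).SameCycle d d' := by
  rw [facePerm_relabelGraph, sameCycle_permCongr]

lemma numFaces_relabelGraph : numFaces (relabelGraph s φ ρ σ) = numFaces σ :=
  (Nat.card_congr <| Quotient.congr (relabel s φ ρ) fun d d' =>
    (sameCycle_facePerm_relabelGraph s φ ρ σ d d').symm).symm

variable {σ}

lemma IsContraction.relabelGraph (h : IsContraction σ) :
    IsContraction (relabelGraph s φ ρ σ) := by
  obtain ⟨hinv, hne, hext⟩ := h
  refine ⟨(relabel s φ ρ).surjective.forall.2 fun d => ?_,
    (relabel s φ ρ).surjective.forall.2 fun d => ?_, fun i => ?_⟩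
  · simp only [relabelGraph_relabel, hinv]
  · simpa only [relabelGraph_relabel, ne_eq, EmbeddingLike.apply_eq_iff_eq] using hne d
  · obtain ⟨⟨v, a⟩, h⟩ := hext (i - s)
    refine ⟨(φ v, a + ρ v), ?_⟩
    rw [← relabel_inr s φ ρ, ← h, ← relabelGraph_relabel, relabel_inl, sub_add_cancel]

lemma VertexAdj.relabelGraph {R : Set (Dart k n₁ n₂)} {v w : Vertex n₁ n₂}
    (h : VertexAdj σ R v w) :
    VertexAdj (relabelGraph s φ ρ σ) (relabel s φ ρ '' R) (φ v) (φ w) := by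
  obtain ⟨i, j, hij, hi, hj⟩ := h
  refine ⟨i + ρ v, j + ρ w, ?_, ?_, ?_⟩
  · rw [← relabel_inr s, relabelGraph_relabel, hij, relabel_inr]
  · rwa [← relabel_inr s, (relabel s φ ρ).injective.mem_set_image]
  · rwa [← relabel_inr s, (relabel s φ ρ).injective.mem_set_image]

lemma IsOnePI.relabelGraph (h : IsOnePI σ) : IsOnePI (relabelGraph s φ ρ σ) := by
  have lift {R : Set (Dart k n₁ n₂)} (hR : ∀ v w, Relation.ReflTransGen (VertexAdj σ R) v w)
      (v w : Vertex m₁ m₂) : Relation.ReflTransGen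
        (VertexAdj (ColorGW.relabelGraph s φ ρ σ) (relabel s φ ρ '' R)) v w := by
    obtain ⟨v, rfl⟩ := φ.surjective v
    obtain ⟨w, rfl⟩ := φ.surjective w
    exact (hR v w).lift φ fun _ _ => VertexAdj.relabelGraph s φ ρ
  refine ⟨by simpa using lift h.1, fun x x' hx => ?_⟩
  obtain ⟨z, hz⟩ := exists_relabel_inr s φ ρ x
  obtain ⟨z', hz'⟩ := exists_relabel_inr s φ ρ x'
  rw [← hz, ← hz', relabelGraph_relabel, EmbeddingLike.apply_eq_iff_eq] at hx
  simpa [hz, hz', Set.image_pair] using lift (h.2 z z' hx)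

lemma IsPlanarRegular.relabelGraph (h : IsPlanarRegular σ) :
    IsPlanarRegular (relabelGraph s φ ρ σ) := by
  have hn : n₁ + n₂ = m₁ + m₂ := by simpa using Fintype.card_congr φ
  refine ⟨?_, fun i j hij => ?_⟩
  · rw [numFaces_relabelGraph, ← hn, h.1, Fintype.card_congr (relabel s φ ρ)]
  · have := (sameCycle_facePerm_relabelGraph s φ ρ σ (Sum.inl (i - s)) (Sum.inl (j - s))).1
      (by simpa using hij)
    simpa using h.2 _ _ this

/-- The Wick contractions that contribute to the amputated functions, whatever the colors. -/
structure IsAdmissible {k n₁ n₂ : ℕ} (σ : Equiv.Perm (Dart k n₁ n₂)) : Prop where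
  isContraction : IsContraction σ
  isOnePI : IsOnePI σ
  isPlanarRegular : IsPlanarRegular σ

lemma IsAdmissible.relabelGraph (h : IsAdmissible σ) : IsAdmissible (relabelGraph s φ ρ σ) :=
  ⟨h.1.relabelGraph s φ ρ, h.2.relabelGraph s φ ρ, h.3.relabelGraph s φ ρ⟩

end Relabel

section Faces

variable {k n₁ n₂ m₁ m₂ : ℕ}

lemma apply_eq_of_sameCycle {α β : Type*} [Finite α] {f : Equiv.Perm α} {x : α → β}
    (h : ∀ d, x (f d) = x d) {d d' : α} (hd : f.SameCycle d d') : x d = x d' := by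
  obtain ⟨n, rfl⟩ := hd.exists_nat_pow_eq
  induction n with
  | zero => rfl
  | succ n ih => rw [pow_succ', Equiv.Perm.mul_apply, h, ← ih ⟨n, rfl⟩]

lemma mem_labelings {σ : Equiv.Perm (Dart k n₁ n₂)} {Λ : ℕ} {x : Dart k n₁ n₂ → Fin k ⊕ Box Λ} :
    x ∈ labelings σ Λ ↔ (∀ d, x (facePerm σ d) = x d) ∧ (∀ i : Fin k, x (Sum.inl i) = Sum.inl i) ∧
      ∀ d, ∀ i : Fin k, x d = Sum.inl i → (facePerm σ).SameCycle d (Sum.inl i) := by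
  classical
  simp [labelings]

/-- `F` identifies the faces of `σ` with the external indices together with a type `ι` of internal
faces, in such a way that the `i`-th external index belongs to the face of the `i`-th field. -/
structure IsFaceMap {ι : Type*} (σ : Equiv.Perm (Dart k n₁ n₂)) (F : Dart k n₁ n₂ → Fin k ⊕ ι) :
    Prop where
  sameCycle_iff : ∀ d d', (facePerm σ).SameCycle d d' ↔ F d = F d'
  inl : ∀ i, F (Sum.inl i) = Sum.inl i
  surjective : Function.Surjective F

namespace IsFaceMap

variable {ι : Type*} {σ : Equiv.Perm (Dart k n₁ n₂)} {F : Dart k n₁ n₂ → Fin k ⊕ ι}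

lemma numFaces_eq [Fintype ι] (hF : IsFaceMap σ F) : numFaces σ = k + Fintype.card ι := by
  let e : Quotient (Equiv.Perm.SameCycle.setoid (facePerm σ)) ≃ Fin k ⊕ ι :=
    (Quotient.congrRight fun d d' => (hF.sameCycle_iff d d')).trans
      (Setoid.quotientKerEquivOfSurjective F hF.surjective)
  simp [numFaces, Nat.card_congr e]

lemma isPlanarRegular [Fintype ι] (hF : IsFaceMap σ F)
    (hι : 2 * (n₁ + n₂ + 1) + 2 * (k + Fintype.card ι) = k + (n₁ + n₂) * 4 + 4) :
    IsPlanarRegular σ := by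
  refine ⟨by simpa [hF.numFaces_eq] using hι, fun i j hij => ?_⟩
  simpa [hF.inl] using (hF.sameCycle_iff _ _).1 hij

lemma map_mem_labelings (hF : IsFaceMap σ F) {Λ : ℕ} (p : ι → Box Λ) :
    (fun d => Sum.map id p (F d)) ∈ labelings σ Λ := by
  refine mem_labelings.2 ⟨fun d => ?_, fun i => by rw [hF.inl]; rfl, fun d i hd => ?_⟩
  · rw [(hF.sameCycle_iff (facePerm σ d) d).1 (Equiv.Perm.sameCycle_apply_left.2 (.refl _ _))]
  · rw [hF.sameCycle_iff, hF.inl]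
    cases h : F d <;> simp_all

lemma exists_map_eq (hF : IsFaceMap σ F) {Λ : ℕ} {x : Dart k n₁ n₂ → Fin k ⊕ Box Λ}
    (hx : x ∈ labelings σ Λ) : ∃ p : ι → Box Λ, (fun d => Sum.map id p (F d)) = x := by
  obtain ⟨hface, hinl, hext⟩ := mem_labelings.1 hx
  have hconst {d d' : Dart k n₁ n₂} (h : F d = F d') : x d = x d' :=
    apply_eq_of_sameCycle hface ((hF.sameCycle_iff d d').2 h)
  choose r hr using fun a : ι => hF.surjective (Sum.inr a)
  have hinner (a : ι) : ∃ p, x (r a) = Sum.inr p := by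
    rcases hxa : x (r a) with i | p
    · have := (hF.sameCycle_iff _ _).1 (hext _ _ hxa)
      simp [hr, hF.inl] at this
    · exact ⟨p, rfl⟩
  choose p hp using hinner
  refine ⟨p, funext fun d => ?_⟩
  rcases hd : F d with i | a
  · rw [hconst (hd.trans (hF.inl i).symm), hinl]
    rfl
  · rw [hconst (hd.trans (hr a).symm), hp]
    rfl

lemma amplitude_eq [Fintype ι] [DecidableEq ι] (hF : IsFaceMap σ F) (μ : ℝ) (Λ : ℕ)
    (e : Fin k → ℝ × ℝ) :
    amplitude σ μ Λ e = ∑ p : ι → Box Λ, ∏ b ∈ internalEdges σ,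
      edgeValue μ (fun d => indexValue e (Sum.map id p (F d))) b := by
  refine (Finset.sum_bij (fun p _ d => Sum.map id p (F d)) (fun p _ => hF.map_mem_labelings p)
    (fun p _ q _ h => funext fun a => ?_) (fun x hx => ?_) fun p _ => rfl).symm
  · obtain ⟨d, hd⟩ := hF.surjective (Sum.inr a)
    simpa [hd] using congrFun h d
  · obtain ⟨p, hp⟩ := hF.exists_map_eq hx
    exact ⟨p, Finset.mem_univ p, hp⟩

end IsFaceMap

section Relabel

variable [NeZero k] (s : Fin k) (φ : Vertex n₁ n₂ ≃ Vertex m₁ m₂) (ρ : Vertex n₁ n₂ → Fin 4)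
  (σ : Equiv.Perm (Dart k n₁ n₂))

lemma internalEdges_relabelGraph [DecidableEq (Sym2 (Dart k m₁ m₂))] :
    internalEdges (relabelGraph s φ ρ σ) =
      (internalEdges σ).image (Sym2.map (relabel s φ ρ)) := by
  classical
  ext b
  simp only [internalEdges, Finset.mem_image, Finset.mem_filter, Finset.mem_univ, true_and,
    (relabel s φ ρ).surjective.exists, relabelGraph_relabel, isRight_relabel,
    exists_exists_and_eq_and, Sym2.map_mk]

/-- Transport of an assignment of indices to the fields along `relabel s φ ρ`; the external
indices are shifted as well. -/
def relabelLabeling (Λ : ℕ) :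
    (Dart k n₁ n₂ → Fin k ⊕ Box Λ) ≃ (Dart k m₁ m₂ → Fin k ⊕ Box Λ) :=
  Equiv.arrowCongr (relabel s φ ρ) (Equiv.sumCongr (Equiv.addRight s) (Equiv.refl _))

@[simp] lemma relabelLabeling_relabel {Λ : ℕ} (x : Dart k n₁ n₂ → Fin k ⊕ Box Λ)
    (d : Dart k n₁ n₂) :
    relabelLabeling s φ ρ Λ x (relabel s φ ρ d) = Sum.map (· + s) id (x d) := by
  simp only [relabelLabeling, Equiv.arrowCongr_apply, Function.comp_apply,
    Equiv.symm_apply_apply]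
  rfl

lemma relabelLabeling_mem_labelings {Λ : ℕ} {x : Dart k n₁ n₂ → Fin k ⊕ Box Λ} :
    relabelLabeling s φ ρ Λ x ∈ labelings (relabelGraph s φ ρ σ) Λ ↔ x ∈ labelings σ Λ := by
  have hinj : Function.Injective (Sum.map (· + s) id : Fin k ⊕ Box Λ → Fin k ⊕ Box Λ) :=
    (add_left_injective s).sumMap Function.injective_id
  have hinl (d : Dart k n₁ n₂) (i : Fin k) :
      Sum.map (· + s) id (x d) = Sum.inl (i + s) ↔ x d = Sum.inl i :=
    hinj.eq_iff (b := Sum.inl i)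
  rw [mem_labelings, mem_labelings]
  refine and_congr ?_ (and_congr ?_ ?_)
  · simp only [(relabel s φ ρ).surjective.forall, facePerm_relabelGraph,
      Equiv.permCongr_apply, Equiv.symm_apply_apply, relabelLabeling_relabel, hinj.eq_iff]
  · rw [(Equiv.addRight s).surjective.forall]
    simp only [Equiv.coe_addRight, ← relabel_inl s φ ρ, relabelLabeling_relabel, hinl]
  · rw [(relabel s φ ρ).surjective.forall]
    refine forall_congr' fun d => ?_
    rw [(Equiv.addRight s).surjective.forall]
    simp only [Equiv.coe_addRight, ← relabel_inl s φ ρ, relabelLabeling_relabel, hinl,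
      sameCycle_facePerm_relabelGraph]

lemma amplitude_relabelGraph (μ : ℝ) (Λ : ℕ) (e : Fin k → ℝ × ℝ) :
    amplitude (relabelGraph s φ ρ σ) μ Λ e = amplitude σ μ Λ fun i => e (i + s) := by
  classical
  refine (Finset.sum_equiv (relabelLabeling s φ ρ Λ)
    (fun _ => (relabelLabeling_mem_labelings s φ ρ σ).symm) fun x _ => ?_).symm
  rw [internalEdges_relabelGraph,
    Finset.prod_image (Sym2.map.injective (relabel s φ ρ).injective).injOn]
  refine Finset.prod_congr rfl fun b _ => ?_
  have hindex (z : Fin k ⊕ Box Λ) :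
      indexValue e (Sum.map (· + s) id z) = indexValue (fun i => e (i + s)) z := by
    cases z <;> rfl
  induction b with
  | _ d d' => simp [edgeValue, hindex]

end Relabel

end Faces

section Threads

/-- The threads traced out by two maps on a type of fields: those pairing the ends of the
propagators, and the fields of the same color at a vertex. -/
def threadSetoid {α : Type*} (σ m : α → α) : Setoid α :=
  Relation.EqvGen.setoid fun d d' => d' = σ d ∨ d' = m d

lemma threadSetoid_map {α β : Type*} {σ m : α → α} {σ' m' : β → β} {f : α → β}
    (hσ : Function.Semiconj f σ σ') (hm : Function.Semiconj f m m') {d d' : α}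
    (h : (threadSetoid σ m).r d d') : (threadSetoid σ' m').r (f d) (f d') := by
  induction h with
  | rel d d' h =>
    refine .rel _ _ (h.imp ?_ ?_) <;> rintro rfl
    exacts [hσ d, hm d]
  | refl d => exact .refl _
  | symm d d' _ ih => exact .symm _ _ ih
  | trans d d' d'' _ _ ih ih' => exact .trans _ _ _ ih ih'

section Involutive

variable {α : Type*} {σ m : Equiv.Perm α}

lemma sameCycle_mul_apply_apply (hσ : Function.Involutive σ) (hm : Function.Involutive m)
    {d d' : α} : (m * σ).SameCycle (m d) (m d') ↔ (m * σ).SameCycle d d' := by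
  have hm' : m⁻¹ = m := Equiv.ext fun d => by rw [Equiv.Perm.inv_eq_iff_eq, hm]
  have hσ' : σ⁻¹ = σ := Equiv.ext fun d => by rw [Equiv.Perm.inv_eq_iff_eq, hσ]
  have hconj : (m * σ)⁻¹ = m * (m * σ) * m⁻¹ := by
    ext1 d
    simp [mul_inv_rev, hσ', hm', hm (σ (m d))]
  rw [← Equiv.Perm.sameCycle_inv, hconj, Equiv.Perm.sameCycle_conj, hm', hm, hm]

/-- A thread visits its fields alternately along `σ` and `m`, so that it consists of one cycle of
`m * σ` and of the image of that cycle under `m`. -/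
lemma threadSetoid_iff [Finite α] (hσ : Function.Involutive σ) (hm : Function.Involutive m)
    {d d' : α} :
    (threadSetoid σ m).r d d' ↔ (m * σ).SameCycle d d' ∨ (m * σ).SameCycle d (m d') := by
  have hswap {d d' : α} : (m * σ).SameCycle d (m d') ↔ (m * σ).SameCycle (m d) d' := by
    rw [← sameCycle_mul_apply_apply hσ hm, hm]
  constructor
  · intro h
    induction h with
    | rel d d' h =>
      rcases h with rfl | rfl
      · exact .inr (Equiv.Perm.sameCycle_apply_right.2 (.refl _ _))
      · exact .inr (by rw [hm])
    | refl d => exact .inl (.refl _ _)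
    | symm d d' _ ih => exact ih.imp (·.symm) fun h => (hswap.1 h).symm
    | trans d d' d'' _ _ ih ih' =>
      rcases ih with h | h <;> rcases ih' with h' | h'
      · exact .inl (h.trans h')
      · exact .inr (h.trans h')
      · exact .inr (h.trans ((sameCycle_mul_apply_apply hσ hm).2 h'))
      · exact .inl (h.trans (hswap.1 h').symm.symm)
  · have hm_rel (d : α) : (threadSetoid σ m).r d (m d) := .rel _ _ (.inr rfl)
    have hcycle {d d' : α} (h : (m * σ).SameCycle d d') : (threadSetoid σ m).r d d' :=
      Quotient.exact <| apply_eq_of_sameCycle (f := m * σ) (x := Quotient.mk (threadSetoid σ m))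
        (fun d => Quotient.sound
          (.symm _ _ (.trans _ (σ d) _ (.rel _ _ (.inl rfl)) (hm_rel _)))) h
    rintro (h | h)
    · exact hcycle h
    · exact .trans _ _ _ (hcycle h) (.symm _ _ (hm_rel d'))

end Involutive

/-- The three ways to pair off the four fields of a vertex. The middle one is the color pattern of
a parallel vertex after a rotation by one field. -/
def pairing : Fin 3 → Equiv.Perm (Fin 4) :=
  ![parallelMate, Equiv.swap 0 3 * Equiv.swap 1 2, crossedMate]

variable {k n₁ n₂ m₁ m₂ : ℕ}

/-- The index of the color pattern of a vertex whose fields are rotated by `r`. -/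
def rotatedPattern : Vertex n₁ n₂ → Fin 4 → Fin 3
  | Sum.inl _, r => ![0, 1, 0, 1] r
  | Sum.inr _, _ => 2

/-- The pairing of the fields in which the vertex `v` has the color pattern `pairing (c v)`. -/
def patternMate (k : ℕ) (c : Vertex n₁ n₂ → Fin 3) : Equiv.Perm (Dart k n₁ n₂) :=
  Equiv.sumCongr (Equiv.refl _) (Equiv.prodShear (Equiv.refl _) fun v => pairing (c v))

@[simp] lemma patternMate_inl (c : Vertex n₁ n₂ → Fin 3) (i : Fin k) :
    patternMate k c (Sum.inl i) = Sum.inl i := rfl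

@[simp] lemma patternMate_inr (c : Vertex n₁ n₂ → Fin 3) (v : Vertex n₁ n₂) (a : Fin 4) :
    patternMate k c (Sum.inr (v, a)) = Sum.inr (v, pairing (c v) a) := rfl

lemma patternMate_involutive (c : Vertex n₁ n₂ → Fin 3) :
    Function.Involutive (patternMate k c) := by
  have h : ∀ x a, pairing x (pairing x a) = a := by decide
  rintro (i | ⟨v, a⟩) <;> simp [h]

instance (τ : Equiv.Perm (Dart k n₁ n₂)) [hτ : Fact (Function.Involutive τ)]
    (c : Vertex n₁ n₂ → Fin 3) : DecidableRel (threadSetoid τ (patternMate k c)).r :=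
  fun _ _ => decidable_of_iff _ (threadSetoid_iff hτ.out (patternMate_involutive c)).symm

/-- The number of threads that do not end at an external field. -/
def numClosedThreads (τ : Equiv.Perm (Dart k n₁ n₂)) (c : Vertex n₁ n₂ → Fin 3) : ℕ :=
  Nat.card {q : Quotient (threadSetoid τ (patternMate k c)) // ∀ i, q ≠ Quotient.mk _ (Sum.inl i)}

section Relabel

variable [NeZero k] (s : Fin k) (φ : Vertex n₁ n₂ ≃ Vertex m₁ m₂) (ρ : Vertex n₁ n₂ → Fin 4)
  (τ : Equiv.Perm (Dart k n₁ n₂))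

/-- The color patterns of the vertices of `relabelGraph s φ ρ τ`, read on the vertices of `τ`. -/
def pulledPattern (v : Vertex n₁ n₂) : Fin 3 := rotatedPattern (φ v) (ρ v)

lemma colorMate_relabel (d : Dart k n₁ n₂) :
    colorMate (relabel s φ ρ d) = relabel s φ ρ (patternMate k (pulledPattern φ ρ) d) := by
  have hparallel : ∀ a r, parallelMate (a + r) = pairing (![0, 1, 0, 1] r) a + r := by decide
  have hcrossed : ∀ a r, crossedMate (a + r) = pairing 2 a + r := by decide
  rcases d with i | ⟨v, a⟩
  · rfl
  · rw [relabel_inr, patternMate_inr, relabel_inr, pulledPattern]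
    rcases φ v with w | w
    · exact congrArg (fun b => Sum.inr (Sum.inl w, b)) (hparallel a (ρ v))
    · exact congrArg (fun b => Sum.inr (Sum.inr w, b)) (hcrossed a (ρ v))

lemma colorSetoid_relabelGraph (d d' : Dart k n₁ n₂) :
    (colorSetoid (relabelGraph s φ ρ τ)).r (relabel s φ ρ d) (relabel s φ ρ d') ↔
      (threadSetoid τ (patternMate k (pulledPattern φ ρ))).r d d' := by
  have hσ : Function.Semiconj (relabel s φ ρ) τ (relabelGraph s φ ρ τ) := fun d =>
    (relabelGraph_relabel s φ ρ τ d).symm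
  have hm : Function.Semiconj (relabel s φ ρ) (patternMate k (pulledPattern φ ρ)) colorMate :=
    fun d => (colorMate_relabel s φ ρ d).symm
  refine ⟨fun h => ?_, threadSetoid_map hσ hm⟩
  simpa using threadSetoid_map (hσ.inverse_left (relabel s φ ρ).left_inv
    (relabel s φ ρ).right_inv) (hm.inverse_left (relabel s φ ρ).left_inv
    (relabel s φ ρ).right_inv) h

lemma numColorLoops_relabelGraph :
    numColorLoops (relabelGraph s φ ρ τ) = numClosedThreads τ (pulledPattern φ ρ) := by
  refine (Nat.card_congr <| Equiv.subtypeEquiv (Quotient.congr (relabel s φ ρ) fun d d' =>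
    (colorSetoid_relabelGraph s φ ρ τ d d').symm) fun q => ?_).symm
  refine (Equiv.addRight s).forall_congr fun i => not_congr ?_
  induction q using Quotient.inductionOn with
  | h d =>
    rw [Quotient.congr_mk, Quotient.eq, Quotient.eq]
    exact (colorSetoid_relabelGraph s φ ρ τ d (Sum.inl i)).symm

lemma colorMatches_relabelGraph (pattern : Equiv.Perm (Fin k)) :
    ColorMatches (relabelGraph s φ ρ τ) pattern ↔
      ∀ i, (threadSetoid τ (patternMate k (pulledPattern φ ρ))).r (Sum.inl i)
        (Sum.inl (pattern (i + s) - s)) := by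
  refine ((Equiv.addRight s).forall_congr fun i => ?_).symm
  rw [← colorSetoid_relabelGraph s φ ρ τ]
  simp

end Relabel

end Threads

section Models

variable {k n₁ n₂ : ℕ}

lemma isContraction_of_isRight {σ : Equiv.Perm (Dart k n₁ n₂)}
    (h : (∀ d, σ (σ d) = d) ∧ (∀ d, σ d ≠ d) ∧ ∀ i, (σ (Sum.inl i)).isRight) :
    IsContraction σ :=
  ⟨h.1, h.2.1, fun i => Sum.isRight_iff.1 (h.2.2 i)⟩

lemma isOnePI_of_forall_ne {σ : Equiv.Perm (Dart k n₁ n₂)} (hσ : Function.Involutive σ)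
    (h : ∀ (g : Vertex n₁ n₂ × Fin 4) (v w : Vertex n₁ n₂), v ≠ w →
      ∃ i j : Fin 4, σ (Sum.inr (v, i)) = Sum.inr (w, j) ∧ (v, i) ≠ g ∧ (w, j) ≠ g) :
    IsOnePI σ := by
  refine ⟨fun v w => ?_, fun g g' hg v w => ?_⟩ <;> obtain rfl | hvw := eq_or_ne v w
  · exact .refl
  · obtain ⟨i, j, hij, -⟩ := h (v, 0) v w hvw
    exact .single ⟨i, j, hij, by simp⟩
  · exact .refl
  · obtain ⟨i, j, hij, hi, hj⟩ := h g v w hvw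
    have hi' : (v, i) ≠ g' := by
      rintro rfl
      rw [← hg, hσ] at hij
      exact hj (Sum.inr_injective hij.symm)
    have hj' : (w, j) ≠ g' := by
      rintro rfl
      exact hi (Sum.inr_injective (σ.injective (hij.trans hg.symm)))
    exact .single ⟨i, j, hij, by simp [hi, hi'], by simp [hj, hj']⟩

/-- The four external fields contracted with a single vertex. -/
def star : Equiv.Perm (Dart 4 1 0) :=
  Function.Involutive.toPerm
    (fun
      | Sum.inl i => Sum.inr (Sum.inl 0, -i)
      | Sum.inr (Sum.inl _, a) => Sum.inl (-a)
      | Sum.inr (Sum.inr v, _) => v.elim0) (by unfold Function.Involutive; decide)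

/-- A vertex two neighboring fields of which are contracted with each other. -/
def tadpole : Equiv.Perm (Dart 2 1 0) :=
  Function.Involutive.toPerm
    (fun
      | Sum.inl 0 => Sum.inr (Sum.inl 0, 2)
      | Sum.inl 1 => Sum.inr (Sum.inl 0, 1)
      | Sum.inr (Sum.inl _, 0) => Sum.inr (Sum.inl 0, 3)
      | Sum.inr (Sum.inl _, 1) => Sum.inl 1
      | Sum.inr (Sum.inl _, 2) => Sum.inl 0
      | Sum.inr (Sum.inl _, 3) => Sum.inr (Sum.inl 0, 0)
      | Sum.inr (Sum.inr v, _) => v.elim0) (by unfold Function.Involutive; decide)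

/-- Two vertices joined by two propagators. -/
def bubble : Equiv.Perm (Dart 4 2 0) :=
  Function.Involutive.toPerm
    (fun
      | Sum.inl 0 => Sum.inr (Sum.inl 0, 0)
      | Sum.inl 1 => Sum.inr (Sum.inl 0, 3)
      | Sum.inl 2 => Sum.inr (Sum.inl 1, 0)
      | Sum.inl 3 => Sum.inr (Sum.inl 1, 3)
      | Sum.inr (Sum.inl 0, 0) => Sum.inl 0
      | Sum.inr (Sum.inl 0, 1) => Sum.inr (Sum.inl 1, 2)
      | Sum.inr (Sum.inl 0, 2) => Sum.inr (Sum.inl 1, 1)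
      | Sum.inr (Sum.inl 0, 3) => Sum.inl 1
      | Sum.inr (Sum.inl 1, 0) => Sum.inl 2
      | Sum.inr (Sum.inl 1, 1) => Sum.inr (Sum.inl 0, 2)
      | Sum.inr (Sum.inl 1, 2) => Sum.inr (Sum.inl 0, 1)
      | Sum.inr (Sum.inl 1, 3) => Sum.inl 3
      | Sum.inr (Sum.inr v, _) => v.elim0) (by unfold Function.Involutive; decide)

lemma star_involutive : Function.Involutive star := Function.Involutive.toPerm_involutive _

lemma tadpole_involutive : Function.Involutive tadpole := Function.Involutive.toPerm_involutive _

lemma bubble_involutive : Function.Involutive bubble := Function.Involutive.toPerm_involutive _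

/-- The face of a field of `star`. -/
def starFace : Dart 4 1 0 → Fin 4 ⊕ Empty
  | Sum.inl i => Sum.inl i
  | Sum.inr (_, a) => Sum.inl (1 - a)

/-- The face of a field of `tadpole`. -/
def tadpoleFace : Dart 2 1 0 → Fin 2 ⊕ Unit
  | Sum.inl i => Sum.inl i
  | Sum.inr (_, a) => ![Sum.inr (), Sum.inl 0, Sum.inl 1, Sum.inl 0] a

/-- The face of a field of `bubble`. -/
def bubbleFace : Dart 4 2 0 → Fin 4 ⊕ Unit
  | Sum.inl i => Sum.inl i
  | Sum.inr (Sum.inl v, a) => ![![Sum.inl 1, Sum.inl 0, Sum.inr (), Sum.inl 2] a,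
      ![Sum.inl 3, Sum.inl 2, Sum.inr (), Sum.inl 0] a] v
  | Sum.inr (Sum.inr v, _) => v.elim0

lemma isFaceMap_starFace : IsFaceMap star starFace :=
  ⟨by decide +kernel, fun _ => rfl, by unfold Function.Surjective; decide +kernel⟩

lemma isFaceMap_tadpoleFace : IsFaceMap tadpole tadpoleFace :=
  ⟨by decide +kernel, fun _ => rfl, by unfold Function.Surjective; decide +kernel⟩

lemma isFaceMap_bubbleFace : IsFaceMap bubble bubbleFace :=
  ⟨by decide +kernel, fun _ => rfl, by unfold Function.Surjective; decide +kernel⟩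

lemma isAdmissible_star : IsAdmissible star :=
  ⟨isContraction_of_isRight (by decide +kernel),
    isOnePI_of_forall_ne star_involutive (by decide +kernel),
    isFaceMap_starFace.isPlanarRegular rfl⟩

lemma isAdmissible_tadpole : IsAdmissible tadpole :=
  ⟨isContraction_of_isRight (by decide +kernel),
    isOnePI_of_forall_ne tadpole_involutive (by decide +kernel),
    isFaceMap_tadpoleFace.isPlanarRegular rfl⟩

lemma isAdmissible_bubble : IsAdmissible bubble :=
  ⟨isContraction_of_isRight (by decide +kernel),
    isOnePI_of_forall_ne bubble_involutive (by decide +kernel),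
    isFaceMap_bubbleFace.isPlanarRegular rfl⟩

end Models

section Amplitudes

variable {k n₁ n₂ : ℕ}

lemma internalEdges_eq (σ : Equiv.Perm (Dart k n₁ n₂)) :
    internalEdges σ = ({d | d.isRight ∧ (σ d).isRight} : Finset (Dart k n₁ n₂)).image
      fun d => s(d, σ d) := by
  simp only [internalEdges]

lemma internalEdges_star : internalEdges star = ∅ :=
  (internalEdges_eq star).trans (by decide +kernel)

lemma internalEdges_tadpole :
    internalEdges tadpole = {s(Sum.inr (Sum.inl 0, 0), Sum.inr (Sum.inl 0, 3))} :=
  (internalEdges_eq tadpole).trans (by decide +kernel)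

lemma internalEdges_bubble :
    internalEdges bubble = {s(Sum.inr (Sum.inl 0, 1), Sum.inr (Sum.inl 1, 2)),
      s(Sum.inr (Sum.inl 0, 2), Sum.inr (Sum.inl 1, 1))} :=
  (internalEdges_eq bubble).trans (by decide +kernel)

/-- The point of the plane with the coordinates of an element of the box. -/
def boxPoint {Λ : ℕ} (p : Box Λ) : ℝ × ℝ := (((p.1 : ℕ) : ℝ), ((p.2 : ℕ) : ℝ))

/-- The value of a tadpole whose external face carries the index `m`. -/
def tadpoleSum (μ : ℝ) (Λ : ℕ) (m : ℝ × ℝ) : ℝ := ∑ p : Box Λ, propagator μ (boxPoint p) m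

lemma amplitude_star (μ : ℝ) (Λ : ℕ) (e : Fin 4 → ℝ × ℝ) : amplitude star μ Λ e = 1 := by
  rw [isFaceMap_starFace.amplitude_eq, internalEdges_star]
  simp

lemma amplitude_tadpole (μ : ℝ) (Λ : ℕ) (e : Fin 2 → ℝ × ℝ) :
    amplitude tadpole μ Λ e = tadpoleSum μ Λ (e 0) := by
  rw [isFaceMap_tadpoleFace.amplitude_eq, internalEdges_tadpole]
  simp only [Finset.prod_singleton]
  exact (Equiv.funUnique Unit (Box Λ)).sum_comp fun p => propagator μ (boxPoint p) (e 0)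

lemma amplitude_bubble (μ : ℝ) (Λ : ℕ) :
    amplitude bubble μ Λ (fun _ => (0, 0)) = S1 μ Λ := by
  rw [isFaceMap_bubbleFace.amplitude_eq, internalEdges_bubble]
  simp only [Finset.prod_pair (by decide : s((Sum.inr (Sum.inl 0, 1) : Dart 4 2 0),
    Sum.inr (Sum.inl 1, 2)) ≠ s(Sum.inr (Sum.inl 0, 2), Sum.inr (Sum.inl 1, 1)))]
  refine ((Equiv.funUnique Unit (Box Λ)).sum_comp fun p =>
    propagator μ (0, 0) (boxPoint p) * propagator μ (boxPoint p) (0, 0)).trans ?_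
  simp only [propagator, boxPoint, zero_add, add_zero, S1, one_div, sq, mul_inv]

end Amplitudes

section ThreadCounts

instance : Fact (Function.Involutive star) := ⟨star_involutive⟩

instance : Fact (Function.Involutive tadpole) := ⟨tadpole_involutive⟩

instance : Fact (Function.Involutive bubble) := ⟨bubble_involutive⟩

lemma numClosedThreads_eq_card {k n₁ n₂ : ℕ} (τ : Equiv.Perm (Dart k n₁ n₂))
    [Fact (Function.Involutive τ)] (c : Vertex n₁ n₂ → Fin 3) :
    numClosedThreads τ c = Fintype.card {q : Quotient (threadSetoid τ (patternMate k c)) //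
      ∀ i, q ≠ Quotient.mk _ (Sum.inl i)} :=
  Nat.card_eq_fintype_card

lemma numClosedThreads_star : ∀ c, numClosedThreads star c = 0 := by
  simp only [numClosedThreads_eq_card]
  decide +kernel

lemma numClosedThreads_tadpole :
    ∀ c, numClosedThreads tadpole c = if c (Sum.inl 0) = 1 then 1 else 0 := by
  simp only [numClosedThreads_eq_card]
  decide +kernel

lemma numClosedThreads_bubble : ∀ c, numClosedThreads bubble c =
    if c (Sum.inl 0) = 1 ∧ c (Sum.inl 1) = 1 then 1 else 0 := by
  simp only [numClosedThreads_eq_card]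
  decide +kernel

end ThreadCounts

section Orbits

variable {k n₁ n₂ m₁ m₂ : ℕ} [NeZero k]

lemma relabelGraph_injective (s : Fin k) (φ : Vertex m₁ m₂ ≃ Vertex n₁ n₂)
    (ρ : Vertex m₁ m₂ → Fin 4) : Function.Injective (relabelGraph s φ ρ) :=
  (relabel s φ ρ).permCongr.injective

/-- The cyclic shifts of the external fields and rotations of the vertices that preserve `τ`. -/
def automorphisms (τ : Equiv.Perm (Dart k m₁ m₂)) : Finset (Fin k × (Vertex m₁ m₂ → Fin 4)) :=
  {p | relabelGraph p.1 (Equiv.refl _) p.2 τ = τ}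

variable (φ : Vertex m₁ m₂ ≃ Vertex n₁ n₂) {τ : Equiv.Perm (Dart k m₁ m₂)}

lemma card_relabelGraph_eq (p : Fin k × (Vertex m₁ m₂ → Fin 4)) :
    Finset.card {q : Fin k × (Vertex m₁ m₂ → Fin 4) |
      relabelGraph q.1 φ q.2 τ = relabelGraph p.1 φ p.2 τ} = (automorphisms τ).card := by
  refine Finset.card_equiv (Equiv.subRight p) fun q => ?_
  have h : relabelGraph q.1 φ q.2 τ = relabelGraph p.1 φ p.2
      (relabelGraph (q - p).1 (Equiv.refl _) (q - p).2 τ) := by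
    simp [relabelGraph_relabelGraph]
  simp [automorphisms, h, (relabelGraph_injective p.1 φ p.2).eq_iff]

variable (hτ : IsAdmissible τ) (h : ∀ σ : Equiv.Perm (Dart k n₁ n₂), IsAdmissible σ →
  ∃ s ρ, relabelGraph s φ ρ τ = σ)
include hτ h

open Classical in
lemma card_automorphisms_mul_sum (f : Equiv.Perm (Dart k n₁ n₂) → ℝ) :
    (automorphisms τ).card * ∑ σ with IsAdmissible σ, f σ =
      ∑ p : Fin k × (Vertex m₁ m₂ → Fin 4), f (relabelGraph p.1 φ p.2 τ) := by
  have himage : Finset.univ.image (fun p : Fin k × (Vertex m₁ m₂ → Fin 4) =>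
      relabelGraph p.1 φ p.2 τ) = Finset.univ.filter IsAdmissible := by
    ext σ
    simp only [Finset.mem_image, Finset.mem_univ, true_and, Finset.mem_filter]
    constructor
    · rintro ⟨p, rfl⟩
      exact hτ.relabelGraph p.1 φ p.2
    · intro hσ
      obtain ⟨s, ρ, h⟩ := h σ hσ
      exact ⟨(s, ρ), h⟩
  rw [Finset.sum_comp f fun p : Fin k × (Vertex m₁ m₂ → Fin 4) => relabelGraph p.1 φ p.2 τ,
    himage, Finset.mul_sum]
  refine Finset.sum_congr rfl fun σ hσ => ?_
  obtain ⟨p, -, rfl⟩ := Finset.mem_image.1 (himage.symm ▸ hσ)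
  rw [nsmul_eq_mul, ← card_relabelGraph_eq φ p]

/-- The weight of a graph in the expansion of `exp (-V₁ - V₂)`. -/
def graphWeight (n₁ n₂ : ℕ) : ℝ :=
  (-1 / 2 : ℝ) ^ n₁ / (n₁.factorial : ℝ) * ((-1 / 4 : ℝ) ^ n₂ / (n₂.factorial : ℝ))

/-- The threads of `relabelGraph s φ ρ τ` connect the external fields according to `pattern`, where
`c` is the list of the color patterns of the vertices. -/
def ThreadsMatch (τ : Equiv.Perm (Dart k m₁ m₂)) (c : Vertex m₁ m₂ → Fin 3)
    (pattern : Equiv.Perm (Fin k)) (s : Fin k) : Prop :=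
  ∀ i, (threadSetoid τ (patternMate k c)).r (Sum.inl i) (Sum.inl (pattern (i + s) - s))

instance (τ : Equiv.Perm (Dart k m₁ m₂)) [Fact (Function.Involutive τ)] (c : Vertex m₁ m₂ → Fin 3)
    (pattern : Equiv.Perm (Fin k)) (s : Fin k) : Decidable (ThreadsMatch τ c pattern s) :=
  inferInstanceAs (Decidable (∀ _, _))

lemma card_automorphisms_mul_onePICoeff [Fact (Function.Involutive τ)]
    (pattern : Equiv.Perm (Fin k)) (μ N : ℝ) (Λ : ℕ) (e : Fin k → ℝ × ℝ) :
    (automorphisms τ).card * onePICoeff pattern μ N Λ e n₁ n₂ = graphWeight n₁ n₂ *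
      ∑ p : Fin k × (Vertex m₁ m₂ → Fin 4) with
          ThreadsMatch τ (pulledPattern φ p.2) pattern p.1,
        N ^ numClosedThreads τ (pulledPattern φ p.2) *
          amplitude τ μ Λ (fun i => e (i + p.1)) := by
  classical
  have hfilter : (Finset.univ.filter fun σ : Equiv.Perm (Dart k n₁ n₂) =>
      IsContraction σ ∧ IsOnePI σ ∧ IsPlanarRegular σ ∧ ColorMatches σ pattern) =
      Finset.filter (ColorMatches · pattern) {σ | IsAdmissible σ} := by
    ext σ
    simp only [Finset.mem_filter, Finset.mem_univ, true_and]
    exact ⟨fun ⟨h₁, h₂, h₃, h₄⟩ => ⟨⟨h₁, h₂, h₃⟩, h₄⟩, fun ⟨⟨h₁, h₂, h₃⟩, h₄⟩ => ⟨h₁, h₂, h₃, h₄⟩⟩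
  rw [onePICoeff, ← graphWeight, mul_left_comm, hfilter, Finset.sum_filter,
    card_automorphisms_mul_sum φ hτ h, Finset.sum_filter]
  simp only [colorMatches_relabelGraph, numColorLoops_relabelGraph, amplitude_relabelGraph,
    ThreadsMatch]
  congr!

end Orbits

section Classification

variable {k n₁ n₂ : ℕ} {σ : Equiv.Perm (Dart k n₁ n₂)}

lemma IsContraction.apply_eq (h : IsContraction σ) {d d' : Dart k n₁ n₂} (hd : σ d = d') :
    σ d' = d := by
  rw [← hd, h.1]

lemma IsContraction.exists_apply_eq_inl (hσ : IsContraction σ) (S : Finset (Vertex n₁ n₂ × Fin 4))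
    (hS : ∀ x ∈ S, ∃ y, σ (Sum.inr x) = Sum.inr y) (hcard : (n₁ + n₂) * 4 ≤ S.card + k)
    {x : Vertex n₁ n₂ × Fin 4} (hx : x ∉ S) : ∃ j, σ (Sum.inr x) = Sum.inl j := by
  classical
  choose g hg using hσ.2.2
  have hinj : Function.Injective g := fun i j hij =>
    Sum.inl_injective (σ.injective ((hg i).trans (hij ▸ (hg j).symm)))
  have hdisjoint : Disjoint S (Finset.univ.image g) := by
    refine Finset.disjoint_left.2 fun y hyS hy => ?_
    obtain ⟨i, -, rfl⟩ := Finset.mem_image.1 hy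
    obtain ⟨y, hy⟩ := hS _ hyS
    simp [hσ.apply_eq (hg i)] at hy
  have huniv : S ∪ Finset.univ.image g = Finset.univ := by
    refine Finset.eq_univ_of_card _ (le_antisymm (Finset.card_le_univ _) ?_)
    simpa [Finset.card_union_of_disjoint hdisjoint, Finset.card_image_of_injective _ hinj]
  obtain ⟨i, -, rfl⟩ := Finset.mem_image.1
    ((Finset.mem_union.1 (huniv ▸ Finset.mem_univ x)).resolve_left hx)
  exact ⟨i, hσ.apply_eq (hg i)⟩

lemma facePerm_of_eq_inr {d : Dart k n₁ n₂} {v : Vertex n₁ n₂} {a : Fin 4}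
    (h : σ d = Sum.inr (v, a)) : facePerm σ d = Sum.inr (v, a + 1) := by
  rw [facePerm_apply, h, nextDart_inr]

/-- The face of `d` does not carry an external index. -/
def IsInner (σ : Equiv.Perm (Dart k n₁ n₂)) (d : Dart k n₁ n₂) : Prop :=
  ∀ i, ¬ (facePerm σ).SameCycle d (Sum.inl i)

lemma IsPlanarRegular.exists_isInner (h : IsPlanarRegular σ) (hk : k < 2 * (n₁ + n₂ + 1)) :
    ∃ x, IsInner σ (Sum.inr x) := by
  by_contra! hcon
  have hsurj : Function.Surjective fun i : Fin k =>
      Quotient.mk (Equiv.Perm.SameCycle.setoid (facePerm σ)) (Sum.inl i) := by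
    rintro ⟨i | x⟩
    · exact ⟨i, rfl⟩
    · obtain ⟨i, hi⟩ := not_forall_not.1 (hcon x)
      exact ⟨i, Quotient.sound hi.symm⟩
  have hle : numFaces σ ≤ k := by
    simpa [numFaces] using Nat.card_le_card_of_surjective _ hsurj
  have := h.1
  simp only [Fintype.card_sum, Fintype.card_fin, Fintype.card_prod] at this
  omega

lemma IsInner.of_eq_inr {d : Dart k n₁ n₂} (h : IsInner σ d) {v : Vertex n₁ n₂} {a : Fin 4}
    (hd : σ d = Sum.inr (v, a)) : IsInner σ (Sum.inr (v, a + 1)) := fun i => by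
  rw [← facePerm_of_eq_inr hd, Equiv.Perm.sameCycle_apply_left]
  exact h i

section Faces

variable [NeZero k]

lemma facePerm_of_eq_inl {d : Dart k n₁ n₂} {j : Fin k} (h : σ d = Sum.inl j) :
    facePerm σ d = Sum.inl (j + 1) := by
  rw [facePerm_apply, h, nextDart_inl]

lemma IsPlanarRegular.add_one_eq (h : IsPlanarRegular σ) {i j : Fin k} {v : Vertex n₁ n₂}
    {a : Fin 4} (hi : σ (Sum.inl i) = Sum.inr (v, a)) (hj : σ (Sum.inr (v, a + 1)) = Sum.inl j) :
    j + 1 = i := by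
  refine h.2 _ _ ?_
  rw [← facePerm_of_eq_inl hj, ← facePerm_of_eq_inr hi]
  simp [Equiv.Perm.SameCycle.refl]

lemma IsPlanarRegular.add_one_eq' (h : IsPlanarRegular σ) {i j : Fin k} {v w : Vertex n₁ n₂}
    {a b : Fin 4} (hi : σ (Sum.inl i) = Sum.inr (v, a))
    (hab : σ (Sum.inr (v, a + 1)) = Sum.inr (w, b)) (hj : σ (Sum.inr (w, b + 1)) = Sum.inl j) :
    j + 1 = i := by
  refine h.2 _ _ ?_
  rw [← facePerm_of_eq_inl hj, ← facePerm_of_eq_inr hab, ← facePerm_of_eq_inr hi]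
  simp [Equiv.Perm.SameCycle.refl]

lemma IsInner.apply_ne_inl {d : Dart k n₁ n₂} (h : IsInner σ d) (j : Fin k) : σ d ≠ Sum.inl j := by
  intro hj
  refine h (j + 1) ?_
  rw [← facePerm_of_eq_inl hj]
  simp [Equiv.Perm.SameCycle.refl]

lemma relabelGraph_eq_of_forall {m₁ m₂ : ℕ} {τ : Equiv.Perm (Dart k m₁ m₂)}
    (hσ : Function.Involutive σ) (hτ : Function.Involutive τ) {s : Fin k}
    {φ : Vertex m₁ m₂ ≃ Vertex n₁ n₂} {ρ : Vertex m₁ m₂ → Fin 4} (S : Finset (Dart k m₁ m₂))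
    (hS : ∀ d, d ∈ S ∨ τ d ∈ S)
    (h : ∀ d ∈ S, σ (relabel s φ ρ d) = relabel s φ ρ (τ d)) : relabelGraph s φ ρ τ = σ := by
  ext1 d
  obtain ⟨d, rfl⟩ := (relabel s φ ρ).surjective d
  rw [relabelGraph_relabel]
  rcases hS d with hd | hd
  · exact (h d hd).symm
  · rw [← hσ (relabel s φ ρ (τ d)), h _ hd, hτ]

end Faces

lemma eq_inl_zero : ∀ v : Vertex 1 0, v = Sum.inl 0 := by decide

theorem exists_relabelGraph_star_eq {σ : Equiv.Perm (Dart 4 1 0)} (hσ : IsAdmissible σ) :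
    ∃ s ρ, relabelGraph s (Equiv.refl _) ρ star = σ := by
  have hext (i : Fin 4) : ∃ a, σ (Sum.inl i) = Sum.inr (Sum.inl 0, a) := by
    obtain ⟨⟨v, a⟩, h⟩ := hσ.isContraction.2.2 i
    exact ⟨a, by rw [h, eq_inl_zero v]⟩
  choose g hg using hext
  have hstep (i : Fin 4) : g (i - 1) = g i + 1 := by
    obtain ⟨j, hj⟩ := hσ.isContraction.exists_apply_eq_inl ∅ (by simp) (by simp)
      (Finset.notMem_empty (Sum.inl 0, g i + 1))
    have hgj := (hg j).symm.trans (hσ.isContraction.apply_eq hj)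
    rw [eq_sub_of_add_eq (hσ.isPlanarRegular.add_one_eq (hg i) hj)] at hgj
    simpa using hgj
  have hneg (i : Fin 4) : g i = -i + g 0 := by
    have : ∀ g : Fin 4 → Fin 4, (∀ i, g (i - 1) = g i + 1) → ∀ i, g i = -i + g 0 := by
      decide +kernel
    exact this g hstep i
  refine ⟨0, fun _ => g 0, relabelGraph_eq_of_forall hσ.isContraction.1 star_involutive
    (Finset.univ.map Function.Embedding.inl) (by decide) ?_⟩
  simp only [Finset.forall_mem_map, Function.Embedding.inl_apply, relabel_inl, add_zero, hg]
  exact fun i _ => congrArg (fun a => Sum.inr (Sum.inl 0, a)) (hneg i)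

/-- The internal face of the graph turns around one propagator, which therefore joins neighboring
fields of the vertex. -/
lemma exists_self_link {σ : Equiv.Perm (Dart 2 1 0)} (hσ : IsAdmissible σ) :
    ∃ a t u, σ (Sum.inr (Sum.inl 0, a)) = Sum.inr (Sum.inl 0, a + 3) ∧
      σ (Sum.inr (Sum.inl 0, a + 1)) = Sum.inl t ∧ σ (Sum.inr (Sum.inl 0, a + 2)) = Sum.inl u := by
  obtain ⟨⟨v, a⟩, hinner⟩ := hσ.isPlanarRegular.exists_isInner (by norm_num)
  obtain rfl := eq_inl_zero v
  obtain ⟨b, hab⟩ : ∃ b, σ (Sum.inr (Sum.inl 0, a)) = Sum.inr (Sum.inl 0, b) := by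
    rcases h : σ (Sum.inr (Sum.inl 0, a)) with j | ⟨w, b⟩
    · exact absurd h (hinner.apply_ne_inl j)
    · exact ⟨b, by rw [eq_inl_zero w]⟩
  have hne : a ≠ b := by
    rintro rfl
    exact hσ.isContraction.2.1 _ hab
  have hba := hσ.isContraction.apply_eq hab
  have hext (c : Fin 4) (hca : c ≠ a) (hcb : c ≠ b) :
      ∃ j, σ (Sum.inr (Sum.inl 0, c)) = Sum.inl j := by
    refine hσ.isContraction.exists_apply_eq_inl {(Sum.inl 0, a), (Sum.inl 0, b)} ?_ ?_
      (by simp [hca, hcb])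
    · simp [hab, hba]
    · rw [Finset.card_pair (by simpa using hne)]
  have hb : b + 1 = a := by
    by_contra hcon
    obtain ⟨j, hj⟩ := hext (b + 1) hcon (by simp)
    exact (hinner.of_eq_inr hab).apply_ne_inl j hj
  obtain rfl : b = a + 3 := by rw [← hb, add_assoc]; simp
  obtain ⟨t, ht⟩ := hext (a + 1) (by simp) (by simp)
  obtain ⟨u, hu⟩ := hext (a + 2) (by simp) (by simp)
  exact ⟨a, t, u, hab, ht, hu⟩

theorem exists_relabelGraph_tadpole_eq {σ : Equiv.Perm (Dart 2 1 0)} (hσ : IsAdmissible σ) :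
    ∃ s ρ, relabelGraph s (Equiv.refl _) ρ tadpole = σ := by
  obtain ⟨a, t, u, hlink, ht, hu⟩ := exists_self_link hσ
  have hσt := hσ.isContraction.apply_eq ht
  obtain rfl : u + 1 = t := hσ.isPlanarRegular.add_one_eq hσt (by rwa [add_assoc])
  refine ⟨u, fun _ => a, relabelGraph_eq_of_forall hσ.isContraction.1 tadpole_involutive
    {Sum.inr (Sum.inl 0, 0), Sum.inr (Sum.inl 0, 1), Sum.inr (Sum.inl 0, 2)} (by decide) ?_⟩
  simp [tadpole, add_comm _ a, add_comm _ u, hlink, ht, hu]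

lemma exists_rel_of_reflTransGen {α : Type*} {r : α → α → Prop} {p : α → Prop} {v w : α}
    (h : Relation.ReflTransGen r v w) (hv : p v) (hw : ¬ p w) : ∃ x y, r x y ∧ p x ∧ ¬ p y := by
  induction h with
  | refl => exact absurd hv hw
  | @tail x y _ hxy ih =>
    by_cases hx : p x
    · exact ⟨x, y, hxy, hx, hw⟩
    · exact ih hx

lemma IsOnePI.exists_two_links (h : IsOnePI σ) {v w : Vertex n₁ n₂} (hvw : w ≠ v) :
    ∃ (i i' : Fin 4) (y y' : Vertex n₁ n₂ × Fin 4), i ≠ i' ∧ y.1 ≠ v ∧ y'.1 ≠ v ∧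
      σ (Sum.inr (v, i)) = Sum.inr y ∧ σ (Sum.inr (v, i')) = Sum.inr y' := by
  obtain ⟨_, y, ⟨i, j, hij, -, -⟩, rfl, hy⟩ :=
    exists_rel_of_reflTransGen (p := (· = v)) (h.1 v w) rfl hvw
  obtain ⟨_, y', ⟨i', j', hij', hi', -⟩, rfl, hy'⟩ :=
    exists_rel_of_reflTransGen (p := (· = _)) (h.2 _ _ hij _ w) rfl hvw
  refine ⟨i, i', (y, j), (y', j'), ?_, hy, hy', hij, hij'⟩
  rintro rfl
  simp at hi'

section Bubble

variable {σ : Equiv.Perm (Dart 4 2 0)} {i i' j j' : Fin 4}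

/-- Two propagators join the vertices of `σ`, the first one from the field `i` to the field `j`
and the second one from `i'` to `j'`, and all other fields are contracted with external ones. -/
structure IsDoubleLink (σ : Equiv.Perm (Dart 4 2 0)) (i i' j j' : Fin 4) : Prop where
  left_ne : i ≠ i'
  right_ne : j ≠ j'
  first : σ (Sum.inr (Sum.inl 0, i)) = Sum.inr (Sum.inl 1, j)
  second : σ (Sum.inr (Sum.inl 0, i')) = Sum.inr (Sum.inl 1, j')
  left_external : ∀ a, a ≠ i → a ≠ i' → ∃ t, σ (Sum.inr (Sum.inl 0, a)) = Sum.inl t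
  right_external : ∀ b, b ≠ j → b ≠ j' → ∃ t, σ (Sum.inr (Sum.inl 1, b)) = Sum.inl t

lemma IsDoubleLink.symm (h : IsDoubleLink σ i i' j j') : IsDoubleLink σ i' i j' j :=
  ⟨h.left_ne.symm, h.right_ne.symm, h.second, h.first, fun a ha ha' => h.left_external a ha' ha,
    fun b hb hb' => h.right_external b hb' hb⟩

lemma exists_isDoubleLink (hσ : IsAdmissible σ) : ∃ i i' j j', IsDoubleLink σ i i' j j' := by
  have hright : ∀ v : Vertex 2 0, v ≠ Sum.inl 0 → v = Sum.inl 1 := by decide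
  obtain ⟨i, i', ⟨v, j⟩, ⟨v', j'⟩, hi, hv, hv', h, h'⟩ :=
    hσ.isOnePI.exists_two_links (v := Sum.inl 0) (w := Sum.inl 1) (by decide)
  obtain rfl := hright v hv
  obtain rfl := hright v' hv'
  have hj : j ≠ j' := by
    rintro rfl
    exact hi (by simpa using h.trans h'.symm)
  have hext {x : Vertex 2 0 × Fin 4} (hx : x ∉ ({(Sum.inl 0, i), (Sum.inl 0, i'),
      (Sum.inl 1, j), (Sum.inl 1, j')} : Finset (Vertex 2 0 × Fin 4))) :
      ∃ t, σ (Sum.inr x) = Sum.inl t := by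
    refine hσ.isContraction.exists_apply_eq_inl _ ?_ ?_ hx
    · simp [h, h', hσ.isContraction.apply_eq h, hσ.isContraction.apply_eq h']
    · simp [Finset.card_insert_of_notMem, hi, hj]
  exact ⟨i, i', j, j', hi, hj, h, h', fun a ha ha' => hext (by simp [ha, ha']),
    fun b hb hb' => hext (by simp [hb, hb'])⟩

lemma IsDoubleLink.eq_or_eq_of_isInner_left (h : IsDoubleLink σ i i' j j') {a : Fin 4}
    (ha : IsInner σ (Sum.inr (Sum.inl 0, a))) : a = i ∨ a = i' := by
  by_contra! hcon
  obtain ⟨t, ht⟩ := h.left_external a hcon.1 hcon.2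
  exact ha.apply_ne_inl t ht

lemma IsDoubleLink.eq_or_eq_of_isInner_right (h : IsDoubleLink σ i i' j j') {b : Fin 4}
    (hb : IsInner σ (Sum.inr (Sum.inl 1, b))) : b = j ∨ b = j' := by
  by_contra! hcon
  obtain ⟨t, ht⟩ := h.right_external b hcon.1 hcon.2
  exact hb.apply_ne_inl t ht

lemma exists_isDoubleLink_isInner (hσ : IsAdmissible σ) :
    ∃ i i' j j', IsDoubleLink σ i i' j j' ∧ IsInner σ (Sum.inr (Sum.inl 0, i)) := by
  obtain ⟨i, i', j, j', h⟩ := exists_isDoubleLink hσ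
  suffices ∃ a, IsInner σ (Sum.inr (Sum.inl 0, a)) by
    obtain ⟨a, ha⟩ := this
    rcases h.eq_or_eq_of_isInner_left ha with rfl | rfl
    exacts [⟨_, _, _, _, h, ha⟩, ⟨_, _, _, _, h.symm, ha⟩]
  have hcover : ∀ v : Vertex 2 0, v = Sum.inl 0 ∨ v = Sum.inl 1 := by decide
  obtain ⟨⟨v, b⟩, hb⟩ := hσ.isPlanarRegular.exists_isInner (by norm_num)
  rcases hcover v with rfl | rfl
  · exact ⟨b, hb⟩
  · rcases h.eq_or_eq_of_isInner_right hb with rfl | rfl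
    exacts [⟨_, hb.of_eq_inr (hσ.isContraction.apply_eq h.first)⟩,
      ⟨_, hb.of_eq_inr (hσ.isContraction.apply_eq h.second)⟩]

/-- The internal face turns around the two propagators, which therefore join neighboring fields of
one vertex to neighboring fields of the other one. -/
lemma exists_isDoubleLink_add (hσ : IsAdmissible σ) :
    ∃ a b, IsDoubleLink σ (a + 2) (a + 1) (b + 1) (b + 2) := by
  obtain ⟨i, i', j, j', h, hi⟩ := exists_isDoubleLink_isInner hσ
  have hj := hi.of_eq_inr h.first
  obtain rfl : j + 1 = j' := (h.eq_or_eq_of_isInner_right hj).resolve_left (by simp)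
  obtain rfl : i' + 1 = i := (h.eq_or_eq_of_isInner_left (hj.of_eq_inr
    (hσ.isContraction.apply_eq h.second))).resolve_right (by simp)
  refine ⟨i' - 1, j - 1, ?_⟩
  have hsub : ∀ c : Fin 4, c - 1 + 1 = c ∧ c - 1 + 2 = c + 1 := by decide
  simpa only [hsub] using h

theorem exists_relabelGraph_bubble_eq (hσ : IsAdmissible σ) :
    ∃ s ρ, relabelGraph s (Equiv.refl _) ρ bubble = σ := by
  obtain ⟨a, b, h⟩ := exists_isDoubleLink_add hσ
  have hinv {d d' : Dart 4 2 0} (hd : σ d = d') : σ d' = d := hσ.isContraction.apply_eq hd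
  obtain ⟨s₀, hs₀⟩ := h.left_external a (by simp) (by simp)
  obtain ⟨s₁, hs₁⟩ := h.left_external (a + 3) (by simp) (by simp)
  obtain ⟨s₂, hs₂⟩ := h.right_external b (by simp) (by simp)
  obtain ⟨s₃, hs₃⟩ := h.right_external (b + 3) (by simp) (by simp)
  obtain rfl : s₀ + 1 = s₁ := hσ.isPlanarRegular.add_one_eq (hinv hs₁) (by simpa [add_assoc])
  obtain rfl : s₃ + 1 = s₀ :=
    hσ.isPlanarRegular.add_one_eq' (hinv hs₀) h.second (by simpa [add_assoc])
  obtain rfl : s₂ + 1 = s₃ := hσ.isPlanarRegular.add_one_eq (hinv hs₃) (by simpa [add_assoc])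
  refine ⟨s₂ + 1 + 1, Sum.elim ![a, b] Fin.elim0, relabelGraph_eq_of_forall hσ.isContraction.1
    bubble_involutive {Sum.inr (Sum.inl 0, 0), Sum.inr (Sum.inl 0, 1), Sum.inr (Sum.inl 0, 2),
      Sum.inr (Sum.inl 0, 3), Sum.inr (Sum.inl 1, 0), Sum.inr (Sum.inl 1, 3)} (by decide) ?_⟩
  have hs : ∀ s : Fin 4, s + 1 + 1 + 2 = s ∧ s + 1 + 1 + 3 = s + 1 := by decide
  simp [bubble, add_comm _ a, add_comm _ b, add_comm _ (s₂ + 1 + 1), h.first, h.second, hs₀, hs₁,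
    hs₂, hs₃, hs]

end Bubble

section Transport

variable [NeZero k] {m₁ m₂ : ℕ} {τ : Equiv.Perm (Dart k m₁ m₂)}

lemma exists_relabelGraph_eq (φ : Vertex m₁ m₂ ≃ Vertex n₁ n₂)
    (h : ∀ {σ : Equiv.Perm (Dart k m₁ m₂)}, IsAdmissible σ →
      ∃ s ρ, relabelGraph s (Equiv.refl _) ρ τ = σ)
    {σ : Equiv.Perm (Dart k n₁ n₂)} (hσ : IsAdmissible σ) : ∃ s ρ, relabelGraph s φ ρ τ = σ := by
  obtain ⟨s, ρ, hτ⟩ := h (hσ.relabelGraph 0 φ.symm 0)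
  refine ⟨s, ρ, relabelGraph_injective 0 φ.symm 0 ?_⟩
  rw [← hτ, relabelGraph_relabelGraph]
  simp

end Transport

end Classification

section Coefficients

lemma card_automorphisms_star : (automorphisms star).card = 4 := by decide +kernel

lemma card_automorphisms_tadpole : (automorphisms tadpole).card = 1 := by decide +kernel

lemma card_automorphisms_bubble : (automorphisms bubble).card = 1 := by decide +kernel

lemma sum_pow_ite {P : Type*} (s : Finset P) (B : P → Prop) [DecidablePred B] (N : ℝ) :
    ∑ p ∈ s, N ^ (if B p then 1 else 0) =
      (s.filter B).card * N + (s.filter fun p => ¬ B p).card := by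
  simp [pow_ite, Finset.sum_ite, mul_comm]

variable {n₁ n₂ : ℕ}

lemma onePICoeff_of_star (φ : Vertex 1 0 ≃ Vertex n₁ n₂)
    (pattern : Equiv.Perm (Fin 4)) (μ N : ℝ) (Λ : ℕ) (e : Fin 4 → ℝ × ℝ) :
    4 * onePICoeff pattern μ N Λ e n₁ n₂ = graphWeight n₁ n₂ *
      Finset.card {p : Fin 4 × (Vertex 1 0 → Fin 4) |
        ThreadsMatch star (pulledPattern φ p.2) pattern p.1} := by
  have := card_automorphisms_mul_onePICoeff φ isAdmissible_star
    (fun _ => exists_relabelGraph_eq φ exists_relabelGraph_star_eq) pattern μ N Λ e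
  simpa [card_automorphisms_star, numClosedThreads_star, amplitude_star] using this

/-- The number of graphs with (`b = true`) or without (`b = false`) a closed color loop among the
relabelings of `bubble` with the given external color pattern. -/
def bubbleCount (φ : Vertex 2 0 ≃ Vertex n₁ n₂) (pattern : Equiv.Perm (Fin 4)) (b : Bool) : ℕ :=
  Finset.card {p : Fin 4 × (Vertex 2 0 → Fin 4) |
    ThreadsMatch bubble (pulledPattern φ p.2) pattern p.1 ∧
      (b ↔ pulledPattern φ p.2 (Sum.inl 0) = 1 ∧ pulledPattern φ p.2 (Sum.inl 1) = 1)}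

lemma onePICoeff_of_bubble (φ : Vertex 2 0 ≃ Vertex n₁ n₂)
    (pattern : Equiv.Perm (Fin 4)) (μ N : ℝ) (Λ : ℕ) :
    onePICoeff pattern μ N Λ (fun _ => (0, 0)) n₁ n₂ = graphWeight n₁ n₂ *
      ((bubbleCount φ pattern true * N + bubbleCount φ pattern false) * S1 μ Λ) := by
  have := card_automorphisms_mul_onePICoeff φ isAdmissible_bubble
    (fun _ => exists_relabelGraph_eq φ exists_relabelGraph_bubble_eq) pattern μ N Λ fun _ => (0, 0)
  rw [card_automorphisms_bubble, Nat.cast_one, one_mul] at this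
  simp only [this, numClosedThreads_bubble, amplitude_bubble, ← Finset.sum_mul, sum_pow_ite,
    Finset.filter_filter, bubbleCount, true_iff, Bool.false_eq_true, false_iff]

lemma threadsMatch_tadpole : ∀ c s, ThreadsMatch tadpole c (Equiv.swap 0 1) s := by
  decide +kernel

lemma onePICoeff_of_tadpole (φ : Vertex 1 0 ≃ Vertex n₁ n₂)
    (μ N : ℝ) (Λ : ℕ) (e : Fin 2 → ℝ × ℝ) :
    onePICoeff (Equiv.swap 0 1) μ N Λ e n₁ n₂ = graphWeight n₁ n₂ *
      ((Finset.card {ρ : Vertex 1 0 → Fin 4 | pulledPattern φ ρ (Sum.inl 0) = 1} * N +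
        Finset.card {ρ : Vertex 1 0 → Fin 4 | ¬ pulledPattern φ ρ (Sum.inl 0) = 1}) *
          (tadpoleSum μ Λ (e 0) + tadpoleSum μ Λ (e 1))) := by
  have := card_automorphisms_mul_onePICoeff φ isAdmissible_tadpole
    (fun _ => exists_relabelGraph_eq φ exists_relabelGraph_tadpole_eq) (Equiv.swap 0 1) μ N Λ e
  rw [card_automorphisms_tadpole, Nat.cast_one, one_mul] at this
  simp only [this, threadsMatch_tadpole, Finset.filter_true, Fintype.sum_prod_type_right,
    numClosedThreads_tadpole, amplitude_tadpole, zero_add, Fin.sum_univ_two, ← mul_add,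
    ← Finset.sum_mul, sum_pow_ite]

lemma bubbleCount_parallel_two_zero :
    bubbleCount (Equiv.refl (Vertex 2 0)) parallelMate = fun b => cond b 8 24 := by decide +kernel

lemma bubbleCount_crossed_two_zero :
    bubbleCount (Equiv.refl (Vertex 2 0)) crossedMate = fun _ => 0 := by decide +kernel

/-- The identification of a pair of parallel vertices with a parallel and a crossed one. -/
def vertexOneOne : Vertex 2 0 ≃ Vertex 1 1 :=
  (Equiv.sumEmpty _ _).trans (finSumFinEquiv (m := 1) (n := 1)).symm

lemma bubbleCount_parallel_one_one :
    bubbleCount vertexOneOne parallelMate = fun b => cond b 0 16 := by decide +kernel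

lemma bubbleCount_crossed_one_one :
    bubbleCount vertexOneOne crossedMate = fun b => cond b 0 32 := by decide +kernel

lemma bubbleCount_parallel_zero_two :
    bubbleCount (Equiv.sumComm (Fin 2) (Fin 0)) parallelMate = fun b => cond b 0 32 := by
  decide +kernel

lemma bubbleCount_crossed_zero_two :
    bubbleCount (Equiv.sumComm (Fin 2) (Fin 0)) crossedMate = fun _ => 0 := by decide +kernel

end Coefficients

section CoefficientValues

lemma onePICoeff_zero_zero {k : ℕ} [NeZero k] (pattern : Equiv.Perm (Fin k)) (μ N : ℝ) (Λ : ℕ)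
    (e : Fin k → ℝ × ℝ) : onePICoeff pattern μ N Λ e 0 0 = 0 := by
  classical
  have h (σ : Equiv.Perm (Dart k 0 0)) : ¬ IsContraction σ := fun hσ =>
    isEmptyElim (hσ.2.2 0).choose.1
  simp [onePICoeff, h]

variable (μ N : ℝ) (Λ : ℕ)

lemma selfEnergyCoeff_zero_zero (m n : ℝ × ℝ) : selfEnergyCoeff μ N Λ m n 0 0 = 0 :=
  onePICoeff_zero_zero _ _ _ _ _

lemma selfEnergyCoeff_one_zero (m n : ℝ × ℝ) :
    selfEnergyCoeff μ N Λ m n 1 0 = -(N + 1) * (tadpoleSum μ Λ m + tadpoleSum μ Λ n) := by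
  have h : Finset.card {ρ | pulledPattern (Equiv.refl (Vertex 1 0)) ρ (Sum.inl 0) = 1} = 2 ∧
      Finset.card {ρ | ¬ pulledPattern (Equiv.refl (Vertex 1 0)) ρ (Sum.inl 0) = 1} = 2 := by
    decide +kernel
  rw [selfEnergyCoeff, onePICoeff_of_tadpole (Equiv.refl _), h.1, h.2]
  norm_num [graphWeight]
  ring

lemma selfEnergyCoeff_zero_one (m n : ℝ × ℝ) :
    selfEnergyCoeff μ N Λ m n 0 1 = -(tadpoleSum μ Λ m + tadpoleSum μ Λ n) := by
  have h : Finset.card {ρ | pulledPattern (Equiv.sumComm (Fin 1) (Fin 0)) ρ (Sum.inl 0) = 1} = 0 ∧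
      Finset.card {ρ | ¬ pulledPattern (Equiv.sumComm (Fin 1) (Fin 0)) ρ (Sum.inl 0) = 1} = 4 := by
    decide +kernel
  rw [selfEnergyCoeff, onePICoeff_of_tadpole (Equiv.sumComm _ _), h.1, h.2]
  norm_num [graphWeight]
  ring

variable (e : Fin 4 → ℝ × ℝ)

lemma onePICoeff_parallel_one_zero : onePICoeff parallelMate μ N Λ e 1 0 = -1 := by
  have h : Finset.card {p : Fin 4 × (Vertex 1 0 → Fin 4) |
      ThreadsMatch star (pulledPattern (Equiv.refl _) p.2) parallelMate p.1} = 8 := by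
    decide +kernel
  have := onePICoeff_of_star (Equiv.refl _) parallelMate μ N Λ e
  rw [h] at this
  norm_num [graphWeight] at this
  linarith

lemma onePICoeff_crossed_one_zero : onePICoeff crossedMate μ N Λ e 1 0 = 0 := by
  have h : Finset.card {p : Fin 4 × (Vertex 1 0 → Fin 4) |
      ThreadsMatch star (pulledPattern (Equiv.refl _) p.2) crossedMate p.1} = 0 := by
    decide +kernel
  have := onePICoeff_of_star (Equiv.refl _) crossedMate μ N Λ e
  rw [h] at this
  norm_num at this
  exact this

lemma onePICoeff_parallel_zero_one : onePICoeff parallelMate μ N Λ e 0 1 = 0 := by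
  have h : Finset.card {p : Fin 4 × (Vertex 1 0 → Fin 4) |
      ThreadsMatch star (pulledPattern (Equiv.sumComm _ _) p.2) parallelMate p.1} = 0 := by
    decide +kernel
  have := onePICoeff_of_star (Equiv.sumComm _ _) parallelMate μ N Λ e
  rw [h] at this
  norm_num at this
  exact this

lemma onePICoeff_crossed_zero_one : onePICoeff crossedMate μ N Λ e 0 1 = -1 := by
  have h : Finset.card {p : Fin 4 × (Vertex 1 0 → Fin 4) |
      ThreadsMatch star (pulledPattern (Equiv.sumComm _ _) p.2) crossedMate p.1} = 16 := by
    decide +kernel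
  have := onePICoeff_of_star (Equiv.sumComm _ _) crossedMate μ N Λ e
  rw [h] at this
  norm_num [graphWeight] at this
  linarith

lemma onePICoeff_parallel_two_zero :
    onePICoeff parallelMate μ N Λ (fun _ => (0, 0)) 2 0 = (N + 3) * S1 μ Λ := by
  rw [onePICoeff_of_bubble (Equiv.refl _), bubbleCount_parallel_two_zero]
  norm_num [graphWeight]
  ring

lemma onePICoeff_crossed_two_zero :
    onePICoeff crossedMate μ N Λ (fun _ => (0, 0)) 2 0 = 0 := by
  rw [onePICoeff_of_bubble (Equiv.refl _), bubbleCount_crossed_two_zero]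
  norm_num

lemma onePICoeff_parallel_one_one :
    onePICoeff parallelMate μ N Λ (fun _ => (0, 0)) 1 1 = 2 * S1 μ Λ := by
  rw [onePICoeff_of_bubble vertexOneOne, bubbleCount_parallel_one_one]
  norm_num [graphWeight]
  ring

lemma onePICoeff_crossed_one_one :
    onePICoeff crossedMate μ N Λ (fun _ => (0, 0)) 1 1 = 4 * S1 μ Λ := by
  rw [onePICoeff_of_bubble vertexOneOne, bubbleCount_crossed_one_one]
  norm_num [graphWeight]
  ring

lemma onePICoeff_parallel_zero_two :
    onePICoeff parallelMate μ N Λ (fun _ => (0, 0)) 0 2 = S1 μ Λ := by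
  rw [onePICoeff_of_bubble (Equiv.sumComm _ _), bubbleCount_parallel_zero_two]
  norm_num [graphWeight]
  ring

lemma onePICoeff_crossed_zero_two :
    onePICoeff crossedMate μ N Λ (fun _ => (0, 0)) 0 2 = 0 := by
  rw [onePICoeff_of_bubble (Equiv.sumComm _ _), bubbleCount_crossed_zero_two]
  norm_num

end CoefficientValues

section OrderIdeal

variable {σ R : Type*} [CommRing R]

/-- The ideal of the power series of order at least `n`. -/
def orderIdeal (σ R : Type*) [CommRing R] (n : ℕ) : Ideal (MvPowerSeries σ R) where
  carrier := {f | (n : ℕ∞) ≤ f.order}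
  add_mem' ha hb := (le_min ha hb).trans MvPowerSeries.min_order_le_add
  zero_mem' := by simp
  smul_mem' _ _ hf := (le_add_left hf).trans MvPowerSeries.le_order_mul

lemma mem_orderIdeal {n : ℕ} {f : MvPowerSeries σ R} :
    f ∈ orderIdeal σ R n ↔ ∀ d : σ →₀ ℕ, d.degree < n → MvPowerSeries.coeff d f = 0 := by
  constructor
  · intro h d hd
    exact MvPowerSeries.coeff_of_lt_order ((Nat.cast_lt.2 hd).trans_le h)
  · intro h
    exact MvPowerSeries.le_order fun d hd => h d (by exact_mod_cast hd)

lemma mul_mem_orderIdeal {a b : ℕ} {f g : MvPowerSeries σ R} (hf : f ∈ orderIdeal σ R a)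
    (hg : g ∈ orderIdeal σ R b) : f * g ∈ orderIdeal σ R (a + b) := by
  change ((a + b : ℕ) : ℕ∞) ≤ (f * g).order
  push_cast
  exact (add_le_add hf hg).trans MvPowerSeries.le_order_mul

lemma orderIdeal_anti : Antitone (orderIdeal σ R) := fun _ _ h _ hf =>
  mem_orderIdeal.2 fun d hd => mem_orderIdeal.1 hf d (hd.trans_le h)

lemma X_mem_orderIdeal (i : σ) : (MvPowerSeries.X i : MvPowerSeries σ R) ∈ orderIdeal σ R 1 := by
  rw [mem_orderIdeal]
  intro d hd
  obtain rfl := (Finsupp.degree_eq_zero_iff d).1 (Nat.lt_one_iff.1 hd)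
  exact MvPowerSeries.coeff_zero_X i

lemma constantCoeff_eq_zero_of_mem_orderIdeal {f : MvPowerSeries σ R}
    (hf : f ∈ orderIdeal σ R 1) : MvPowerSeries.constantCoeff f = 0 :=
  mem_orderIdeal.1 hf 0 (by simp)

variable {K : Type*} [Field K] {Z c : MvPowerSeries σ K}

lemma inv_sq_sub_mem_orderIdeal (hc : c ∈ orderIdeal σ K 1)
    (hZ : Z - (1 - c) ∈ orderIdeal σ K 2) :
    (Z ^ 2)⁻¹ - 1 - 2 * c ∈ orderIdeal σ K 2 := by
  set z := Z - (1 - c) with hz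
  have hZz : Z = 1 - c + z := by rw [hz]; ring
  have hZ0 : MvPowerSeries.constantCoeff (Z ^ 2) ≠ 0 := by
    simp [hZz, constantCoeff_eq_zero_of_mem_orderIdeal hc,
      constantCoeff_eq_zero_of_mem_orderIdeal (orderIdeal_anti one_le_two hZ)]
  have hW : (Z ^ 2)⁻¹ * Z ^ 2 = 1 := MvPowerSeries.inv_mul_cancel _ hZ0
  generalize (Z ^ 2)⁻¹ = W at hW ⊢
  have : W - 1 - 2 * c = W * (3 - 2 * c) * (c * c) - W * (2 * (1 - c) + z) * (1 + 2 * c) * z := by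
    rw [hZz] at hW
    linear_combination (1 + 2 * c) * hW
  rw [this]
  exact sub_mem (Ideal.mul_mem_left _ _ (mul_mem_orderIdeal hc hc)) (Ideal.mul_mem_left _ _ hZ)

lemma mul_inv_sq_sub_mem_orderIdeal {G P Q : MvPowerSeries σ K} (hP : P ∈ orderIdeal σ K 1)
    (hQ : Q ∈ orderIdeal σ K 2) (hG : G - (P + Q) ∈ orderIdeal σ K 3)
    (hc : c ∈ orderIdeal σ K 1) (hZ : Z - (1 - c) ∈ orderIdeal σ K 2) :
    G * (Z ^ 2)⁻¹ - (P + Q + 2 * c * P) ∈ orderIdeal σ K 3 := by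
  have h2 := inv_sq_sub_mem_orderIdeal hc hZ
  generalize (Z ^ 2)⁻¹ = W at h2 ⊢
  have h1 : W - 1 ∈ orderIdeal σ K 1 := by
    have := add_mem (orderIdeal_anti one_le_two h2) (Ideal.mul_mem_left _ 2 hc)
    rwa [sub_add_cancel] at this
  have : G * W - (P + Q + 2 * c * P) =
      W * (G - (P + Q)) + P * (W - 1 - 2 * c) + Q * (W - 1) := by ring
  rw [this]
  exact add_mem (add_mem (Ideal.mul_mem_left _ _ hG) (mul_mem_orderIdeal hP h2))
    (mul_mem_orderIdeal hQ h1)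

end OrderIdeal

section QuadraticSeries

variable {R : Type*} [CommRing R]

lemma eqModCubic_iff {f g : MvPowerSeries (Fin 2) ℝ} :
    EqModCubic f g ↔ f - g ∈ orderIdeal (Fin 2) ℝ 3 := by
  rw [mem_orderIdeal]
  refine forall_congr' fun d => ?_
  rw [Finsupp.degree_eq_sum, Fin.sum_univ_two, Nat.lt_succ_iff, map_sub, sub_eq_zero]

/-- The linear form with the given coefficients in the two couplings. -/
def linearSeries (c₁₀ c₀₁ : R) : MvPowerSeries (Fin 2) R :=
  MvPowerSeries.C c₁₀ * MvPowerSeries.X 0 + MvPowerSeries.C c₀₁ * MvPowerSeries.X 1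

/-- The quadratic form with the given coefficients in the two couplings. -/
def quadraticSeries (c₂₀ c₁₁ c₀₂ : R) : MvPowerSeries (Fin 2) R :=
  MvPowerSeries.C c₂₀ * MvPowerSeries.X 0 ^ 2 +
    MvPowerSeries.C c₁₁ * MvPowerSeries.X 0 * MvPowerSeries.X 1 +
    MvPowerSeries.C c₀₂ * MvPowerSeries.X 1 ^ 2

lemma linearSeries_mem_orderIdeal (c₁₀ c₀₁ : R) :
    linearSeries c₁₀ c₀₁ ∈ orderIdeal (Fin 2) R 1 :=
  add_mem (Ideal.mul_mem_left _ _ (X_mem_orderIdeal 0))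
    (Ideal.mul_mem_left _ _ (X_mem_orderIdeal 1))

lemma quadraticSeries_mem_orderIdeal (c₂₀ c₁₁ c₀₂ : R) :
    quadraticSeries c₂₀ c₁₁ c₀₂ ∈ orderIdeal (Fin 2) R 2 := by
  have h (i j : Fin 2) := mul_mem_orderIdeal (R := R) (X_mem_orderIdeal i) (X_mem_orderIdeal j)
  rw [quadraticSeries, sq, sq, mul_assoc (MvPowerSeries.C c₁₁)]
  exact add_mem (add_mem (Ideal.mul_mem_left _ _ (h 0 0)) (Ideal.mul_mem_left _ _ (h 0 1)))
    (Ideal.mul_mem_left _ _ (h 1 1))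

lemma coeff_C_mul_X_pow_mul_X_pow (d : Fin 2 →₀ ℕ) (c : R) (a b : ℕ) :
    MvPowerSeries.coeff d (MvPowerSeries.C c * MvPowerSeries.X 0 ^ a * MvPowerSeries.X 1 ^ b) =
      if d 0 = a ∧ d 1 = b then c else 0 := by
  rw [mul_assoc, MvPowerSeries.coeff_C_mul, MvPowerSeries.X_pow_eq, MvPowerSeries.X_pow_eq,
    MvPowerSeries.monomial_mul_monomial, MvPowerSeries.coeff_monomial]
  have : d = Finsupp.single 0 a + Finsupp.single 1 b ↔ d 0 = a ∧ d 1 = b := by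
    simp [Finsupp.ext_iff, Fin.forall_fin_two]
  simp [this]

lemma coeff_linearSeries_add_quadraticSeries (c₁₀ c₀₁ c₂₀ c₁₁ c₀₂ : R) (d : Fin 2 →₀ ℕ) :
    MvPowerSeries.coeff d (linearSeries c₁₀ c₀₁ + quadraticSeries c₂₀ c₁₁ c₀₂) =
      (if d 0 = 1 ∧ d 1 = 0 then c₁₀ else 0) + (if d 0 = 0 ∧ d 1 = 1 then c₀₁ else 0) +
      ((if d 0 = 2 ∧ d 1 = 0 then c₂₀ else 0) + (if d 0 = 1 ∧ d 1 = 1 then c₁₁ else 0) +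
        (if d 0 = 0 ∧ d 1 = 2 then c₀₂ else 0)) := by
  simp only [← coeff_C_mul_X_pow_mul_X_pow, ← map_add]
  simp [linearSeries, quadraticSeries]

lemma sub_linearSeries_add_quadraticSeries_mem (F : ℕ → ℕ → R) (h : F 0 0 = 0) :
    (show MvPowerSeries (Fin 2) R from fun d => F (d 0) (d 1)) -
      (linearSeries (F 1 0) (F 0 1) + quadraticSeries (F 2 0) (F 1 1) (F 0 2)) ∈
        orderIdeal (Fin 2) R 3 := by
  rw [mem_orderIdeal]
  intro d hd
  rw [Finsupp.degree_eq_sum, Fin.sum_univ_two] at hd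
  rw [map_sub, coeff_linearSeries_add_quadraticSeries]
  change F (d 0) (d 1) - _ = 0
  generalize d 0 = a at *
  generalize d 1 = b at *
  have ha : a ≤ 2 := by omega
  have hb : b ≤ 2 := by omega
  interval_cases a <;> interval_cases b <;> first | omega | simp [h]

end QuadraticSeries

section RenormalizedCouplings

lemma two_le_massA (μ : ℝ) : 2 ≤ massA μ :=
  le_add_of_nonneg_right (by positivity)

lemma massA_pos (μ : ℝ) : 0 < massA μ := two_pos.trans_le (two_le_massA μ)

lemma hasDerivAt_propagator_boxPoint (μ : ℝ) {Λ : ℕ} (p : Box Λ) :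
    HasDerivAt (fun t : ℝ => propagator μ (boxPoint p) (t, 0))
      (-(1 / (((p.1 : ℕ) : ℝ) + ((p.2 : ℕ) : ℝ) + massA μ) ^ 2)) 0 := by
  have hpos := massA_pos μ
  have hlin : HasDerivAt (fun t : ℝ => ((p.1 : ℕ) : ℝ) + ((p.2 : ℕ) : ℝ) + t + 0 + massA μ) 1 0 :=
    (((hasDerivAt_id 0).const_add _).add_const 0).add_const _
  exact (hlin.fun_inv (by positivity)).congr_deriv (by simp [neg_div])

lemma hasDerivAt_tadpoleSum (μ : ℝ) (Λ : ℕ) :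
    HasDerivAt (fun t : ℝ => tadpoleSum μ Λ (t, 0)) (-S1 μ Λ) 0 := by
  rw [S1, ← Finset.sum_neg_distrib]
  exact HasDerivAt.fun_sum fun p _ => hasDerivAt_propagator_boxPoint μ p

variable (μ N : ℝ) (Λ : ℕ)

lemma dSelfEnergy_sub_mem :
    dSelfEnergy μ N Λ - linearSeries ((N + 1) * S1 μ Λ) (S1 μ Λ) ∈ orderIdeal (Fin 2) ℝ 2 := by
  set F : ℕ → ℕ → ℝ := fun a b =>
    deriv (fun t : ℝ => selfEnergyCoeff μ N Λ (t, 0) (0, 0) a b) 0 with hF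
  have hd := (hasDerivAt_tadpoleSum μ Λ).add_const (tadpoleSum μ Λ (0, 0))
  have h00 : F 0 0 = 0 := by simp [hF, selfEnergyCoeff_zero_zero]
  have h10 : F 1 0 = (N + 1) * S1 μ Λ := by
    simp only [hF, selfEnergyCoeff_one_zero, (hd.const_mul (-(N + 1))).deriv, neg_mul_neg]
  have h01 : F 0 1 = S1 μ Λ := by
    simp only [hF, selfEnergyCoeff_zero_one, hd.fun_neg.deriv, neg_neg]
  have h := orderIdeal_anti (Nat.le_succ 2) (sub_linearSeries_add_quadraticSeries_mem F h00)
  have h := add_mem h (quadraticSeries_mem_orderIdeal (F 2 0) (F 1 1) (F 0 2))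
  rwa [h10, h01, ← sub_sub, sub_add_cancel] at h

lemma waveZ_sub_mem :
    waveZ μ N Λ - (1 - linearSeries ((N + 1) * S1 μ Λ) (S1 μ Λ)) ∈ orderIdeal (Fin 2) ℝ 2 := by
  rw [waveZ, sub_sub_sub_cancel_left, ← neg_sub]
  exact neg_mem (dSelfEnergy_sub_mem μ N Λ)

lemma lambdaR_sub_mem (i : Fin 2) {P Q : MvPowerSeries (Fin 2) ℝ}
    (hP : P ∈ orderIdeal (Fin 2) ℝ 1) (hQ : Q ∈ orderIdeal (Fin 2) ℝ 2)
    (hG : gammaFour μ N Λ i - (P + Q) ∈ orderIdeal (Fin 2) ℝ 3) :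
    EqModCubic (lambdaR μ N Λ i)
      (-(P + Q + 2 * linearSeries ((N + 1) * S1 μ Λ) (S1 μ Λ) * P)) := by
  rw [eqModCubic_iff, lambdaR, neg_mul, neg_sub_neg, ← neg_sub]
  exact neg_mem (mul_inv_sq_sub_mem_orderIdeal hP hQ hG (linearSeries_mem_orderIdeal _ _)
    (waveZ_sub_mem μ N Λ))

lemma gammaFour_zero_sub_mem :
    gammaFour μ N Λ 0 - (linearSeries (-1) 0 +
      quadraticSeries ((N + 3) * S1 μ Λ) (2 * S1 μ Λ) (S1 μ Λ)) ∈ orderIdeal (Fin 2) ℝ 3 := by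
  have h := sub_linearSeries_add_quadraticSeries_mem
    (onePICoeff parallelMate μ N Λ fun _ => (0, 0)) (onePICoeff_zero_zero ..)
  rwa [onePICoeff_parallel_one_zero, onePICoeff_parallel_zero_one, onePICoeff_parallel_two_zero,
    onePICoeff_parallel_one_one, onePICoeff_parallel_zero_two] at h

lemma gammaFour_one_sub_mem :
    gammaFour μ N Λ 1 - (linearSeries 0 (-1) + quadraticSeries 0 (4 * S1 μ Λ) 0) ∈
      orderIdeal (Fin 2) ℝ 3 := by
  have h := sub_linearSeries_add_quadraticSeries_mem
    (onePICoeff crossedMate μ N Λ fun _ => (0, 0)) (onePICoeff_zero_zero ..)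
  rwa [onePICoeff_crossed_one_zero, onePICoeff_crossed_zero_one, onePICoeff_crossed_two_zero,
    onePICoeff_crossed_one_one, onePICoeff_crossed_zero_two] at h

lemma eqModCubic_lambdaR_zero : EqModCubic (lambdaR μ N Λ 0)
    (linearSeries 1 0 + quadraticSeries (-((1 - N) * S1 μ Λ)) 0 (-S1 μ Λ)) := by
  have := lambdaR_sub_mem μ N Λ 0 (linearSeries_mem_orderIdeal _ _)
    (quadraticSeries_mem_orderIdeal _ _ _) (gammaFour_zero_sub_mem μ N Λ)
  convert this using 1
  simp only [linearSeries, quadraticSeries, map_neg, map_mul, map_add, map_sub, map_one, map_zero,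
    map_ofNat]
  ring

lemma eqModCubic_lambdaR_one : EqModCubic (lambdaR μ N Λ 1)
    (linearSeries 0 1 + quadraticSeries 0 (-(2 * (1 - N) * S1 μ Λ)) (2 * S1 μ Λ)) := by
  have := lambdaR_sub_mem μ N Λ 1 (linearSeries_mem_orderIdeal _ _)
    (quadraticSeries_mem_orderIdeal _ _ _) (gammaFour_one_sub_mem μ N Λ)
  convert this using 1
  simp only [linearSeries, quadraticSeries, map_neg, map_mul, map_add, map_sub, map_one, map_zero,
    map_ofNat]
  ring

end RenormalizedCouplings

section CutOffSum

lemma inv_sub_inv_add_one {x : ℝ} (hx : 0 < x) : 1 / x - 1 / (x + 1) = 1 / (x * (x + 1)) := by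
  field_simp
  ring

lemma sum_inv_sub_inv_add_one (x : ℝ) (n : ℕ) :
    ∑ q ∈ Finset.range n, (1 / (x + q) - 1 / (x + q + 1)) = 1 / x - 1 / (x + n) := by
  simpa [add_assoc] using Finset.sum_range_sub' (fun q : ℕ => 1 / (x + q)) n

lemma sum_one_div_sq_le {x : ℝ} (hx : 0 < x) (n : ℕ) :
    ∑ q ∈ Finset.range n, 1 / (x + 1 + q) ^ 2 ≤ 1 / x := by
  calc ∑ q ∈ Finset.range n, 1 / (x + 1 + q) ^ 2
      ≤ ∑ q ∈ Finset.range n, (1 / (x + q) - 1 / (x + q + 1)) := by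
        refine Finset.sum_le_sum fun q _ => ?_
        rw [inv_sub_inv_add_one (by positivity)]
        exact one_div_le_one_div_of_le (by positivity) (by nlinarith [Nat.cast_nonneg (α := ℝ) q])
    _ = 1 / x - 1 / (x + n) := sum_inv_sub_inv_add_one x n
    _ ≤ 1 / x := sub_le_self _ (by positivity)

lemma le_sum_one_div_sq {x : ℝ} (hx : 0 < x) (n : ℕ) :
    1 / x - 1 / (x + n) ≤ ∑ q ∈ Finset.range n, 1 / (x + q) ^ 2 := by
  rw [← sum_inv_sub_inv_add_one]
  refine Finset.sum_le_sum fun q _ => ?_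
  rw [inv_sub_inv_add_one (by positivity)]
  exact one_div_le_one_div_of_le (by positivity) (by nlinarith [Nat.cast_nonneg (α := ℝ) q])

lemma log_add_one_sub_log_le {x : ℝ} (hx : 0 < x) : Real.log (x + 1) - Real.log x ≤ 1 / x := by
  rw [← Real.log_div (by positivity) hx.ne', add_div, div_self hx.ne']
  linarith [Real.log_le_sub_one_of_pos (x := 1 + 1 / x) (by positivity)]

lemma log_add_sub_log_le_sum {x : ℝ} (hx : 0 < x) (n : ℕ) :
    Real.log (x + n) - Real.log x ≤ ∑ p ∈ Finset.range n, 1 / (x + p) := by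
  calc Real.log (x + n) - Real.log x
      = ∑ p ∈ Finset.range n, (Real.log (x + p + 1) - Real.log (x + p)) := by
        simpa [add_assoc] using (Finset.sum_range_sub (fun p : ℕ => Real.log (x + p)) n).symm
    _ ≤ ∑ p ∈ Finset.range n, 1 / (x + p) :=
        Finset.sum_le_sum fun p _ => log_add_one_sub_log_le (by positivity)

variable (μ : ℝ) (Λ : ℕ)

lemma S1_eq_sum : S1 μ Λ = ∑ p ∈ Finset.range (Λ + 1), ∑ q ∈ Finset.range (Λ + 1),
    1 / (massA μ + p + q) ^ 2 := by
  rw [S1, Fintype.sum_prod_type, Finset.sum_range]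
  refine Finset.sum_congr rfl fun p _ => ?_
  rw [Finset.sum_range]
  exact Finset.sum_congr rfl fun q _ => by ring_nf

lemma S1_pos : 0 < S1 μ Λ := by
  have := massA_pos μ
  exact Finset.sum_pos (fun p _ => by positivity) Finset.univ_nonempty

lemma S1_le : S1 μ Λ ≤ 1 + Real.log (Λ + 1) := by
  have hA := two_le_massA μ
  calc S1 μ Λ = ∑ p ∈ Finset.range (Λ + 1), ∑ q ∈ Finset.range (Λ + 1),
        1 / (massA μ - 1 + p + 1 + q) ^ 2 := by
        have hshift (p : ℝ) : massA μ - 1 + p + 1 = massA μ + p := by ring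
        simp only [hshift, S1_eq_sum]
    _ ≤ ∑ p ∈ Finset.range (Λ + 1), 1 / ((p : ℝ) + 1) := by
        refine Finset.sum_le_sum fun p _ => ?_
        have hp : (p : ℝ) + 1 ≤ massA μ - 1 + p := by linarith
        have hp' : (0 : ℝ) < p + 1 := by positivity
        exact (sum_one_div_sq_le (hp'.trans_le hp) _).trans (one_div_le_one_div_of_le hp' hp)
    _ ≤ 1 + Real.log (Λ + 1) := by
        simpa [harmonic] using harmonic_le_one_add_log (Λ + 1)

lemma le_S1 : Real.log (Λ + 1) - Real.log (massA μ) - 1 ≤ S1 μ Λ := by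
  have hA := massA_pos μ
  calc Real.log (Λ + 1) - Real.log (massA μ) - 1
      ≤ Real.log (massA μ + (Λ + 1 : ℕ)) - Real.log (massA μ) - 1 := by
        push_cast
        linarith [Real.log_le_log (x := Λ + 1) (by positivity) (le_add_of_nonneg_left hA.le)]
    _ ≤ ∑ p ∈ Finset.range (Λ + 1), 1 / (massA μ + p) - 1 :=
        sub_le_sub_right (log_add_sub_log_le_sum hA _) 1
    _ = ∑ p ∈ Finset.range (Λ + 1), (1 / (massA μ + p) - 1 / ((Λ : ℝ) + 1)) := by
        rw [Finset.sum_sub_distrib, Finset.sum_const, Finset.card_range, nsmul_eq_mul]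
        push_cast
        rw [mul_one_div_cancel (by positivity)]
    _ ≤ S1 μ Λ := by
        rw [S1_eq_sum]
        refine Finset.sum_le_sum fun p _ => ?_
        have h := le_sum_one_div_sq (x := massA μ + p) (by positivity) (Λ + 1)
        refine le_trans (sub_le_sub_left (one_div_le_one_div_of_le (by positivity) ?_) _) h
        push_cast
        linarith [Nat.cast_nonneg (α := ℝ) p]

lemma tendsto_S1 : Tendsto (fun Λ : ℕ => S1 μ Λ) atTop atTop := by
  refine tendsto_atTop_mono (le_S1 μ) ?_
  have hlog : Tendsto (fun Λ : ℕ => Real.log ((Λ : ℝ) + 1)) atTop atTop :=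
    Real.tendsto_log_atTop.comp (tendsto_atTop_add_const_right _ 1 tendsto_natCast_atTop_atTop)
  exact tendsto_atTop_add_const_right _ _ (tendsto_atTop_add_const_right _ _ hlog)

lemma S1_sub_log_isBigO :
    (fun Λ : ℕ => S1 μ Λ - Real.log (Λ : ℝ)) =O[atTop] fun _ => (1 : ℝ) := by
  refine IsBigO.of_bound (2 + |Real.log (massA μ)|) ?_
  filter_upwards [eventually_ge_atTop 1] with Λ hΛ
  have hΛ' : (1 : ℝ) ≤ Λ := by exact_mod_cast hΛ
  have hupper : Real.log (Λ + 1) - Real.log Λ ≤ 1 :=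
    (log_add_one_sub_log_le (by positivity)).trans ((div_le_one (by positivity)).2 hΛ')
  have hlower : Real.log Λ ≤ Real.log (Λ + 1) := Real.log_le_log (by positivity) (by linarith)
  rw [norm_one, mul_one, Real.norm_eq_abs, abs_le]
  constructor <;>
    linarith [S1_le μ Λ, le_S1 μ Λ, le_abs_self (Real.log (massA μ)),
      abs_nonneg (Real.log (massA μ))]

end CutOffSum

section BetaFunction

lemma flowCoeff_of_eqModCubic {μ N : ℝ} {Λ : ℕ} {i : Fin 2} {f : MvPowerSeries (Fin 2) ℝ}
    (h : EqModCubic (lambdaR μ N Λ i) f) {a b : ℕ} (hab : a + b ≤ 2) :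
    flowCoeff μ N Λ i a b =
      -MvPowerSeries.coeff (Finsupp.single 0 a + Finsupp.single 1 b) f / S1 μ Λ := by
  rw [flowCoeff, h _ (by simpa using hab)]

variable (μ N : ℝ) (Λ : ℕ)

lemma betaParallel_eq : betaParallel μ N Λ = 1 - N := by
  rw [betaParallel, flowCoeff_of_eqModCubic (eqModCubic_lambdaR_zero μ N Λ) (by norm_num),
    coeff_linearSeries_add_quadraticSeries]
  simp [(S1_pos μ Λ).ne']

lemma betaCrossed_eq : betaCrossed μ N Λ = -2 := by
  rw [betaCrossed, flowCoeff_of_eqModCubic (eqModCubic_lambdaR_one μ N Λ) (by norm_num),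
    coeff_linearSeries_add_quadraticSeries]
  simp [neg_div, (S1_pos μ Λ).ne']

lemma flowCoeff_one_two_zero : flowCoeff μ N Λ 1 2 0 = 0 := by
  rw [flowCoeff_of_eqModCubic (eqModCubic_lambdaR_one μ N Λ) (by norm_num),
    coeff_linearSeries_add_quadraticSeries]
  simp

lemma betaFunction_parallel (x : ℝ) :
    betaFunction μ N Λ ![x, 0] = ![(1 - N) * x ^ 2, 0] := by
  have h : flowCoeff μ N Λ 0 2 0 = 1 - N := betaParallel_eq μ N Λ
  funext i
  fin_cases i <;> simp [betaFunction, h, flowCoeff_one_two_zero]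

lemma betaFunction_parallel_eq_zero_iff :
    (∀ x : ℝ, betaFunction μ N Λ ![x, 0] = 0) ↔ N = 1 := by
  simp only [betaFunction_parallel]
  constructor
  · intro h
    have : 1 - N = 0 := by simpa using congrFun (h 1) 0
    linarith
  · rintro rfl x
    simp

end BetaFunction

section Riccati

variable {κ g : ℝ}

lemma hasDerivAt_one_sub_mul (c s : ℝ) : HasDerivAt (fun s => 1 - c * s) (-c) s := by
  simpa using ((hasDerivAt_id s).const_mul c).const_sub 1

lemma hasDerivAt_riccati {s : ℝ} (h : 1 - κ * g * s ≠ 0) :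
    HasDerivAt (fun s => g / (1 - κ * g * s)) (κ * (g / (1 - κ * g * s)) ^ 2) s := by
  refine ((hasDerivAt_const s g).fun_div (hasDerivAt_one_sub_mul (κ * g) s) h).congr_deriv ?_
  field_simp
  ring

/-- The function `f s = x s * (1 - κ * x 0 * s) - x 0` solves the linear equation `f' = κ x f` with
initial value zero. -/
lemma mul_one_sub_eq_of_riccati {b : ℝ} {x : ℝ → ℝ} (hb : 0 ≤ b)
    (hx : ∀ s ∈ Set.Icc 0 b, HasDerivWithinAt x (κ * x s ^ 2) (Set.Icc 0 b) s) :
    x b * (1 - κ * x 0 * b) = x 0 := by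
  set f : ℝ → ℝ := fun s => x s * (1 - κ * x 0 * s) - x 0 with hf
  have hf' (s : ℝ) (hs : s ∈ Set.Icc 0 b) :
      HasDerivWithinAt f (κ * x s * f s) (Set.Icc 0 b) s :=
    (((hx s hs).fun_mul (hasDerivAt_one_sub_mul _ s).hasDerivWithinAt).sub_const _).congr_deriv
      (by rw [hf]; ring)
  have hcont : ContinuousOn x (Set.Icc 0 b) := fun s hs => (hx s hs).continuousWithinAt
  obtain ⟨K, hK⟩ := isCompact_Icc.exists_bound_of_continuousOn (hcont.const_smul κ)
  have hzero := eq_zero_of_abs_deriv_le_mul_abs_self_of_eq_zero_right (K := K)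
    (fun s hs => (hf' s hs).continuousWithinAt)
    (fun s hs => (hf' s (Set.Ico_subset_Icc_self hs)).mono_of_mem_nhdsWithin
      (mem_of_superset (Icc_mem_nhdsGE hs.2) (Set.Icc_subset_Icc_left hs.1)))
    (by simp [hf])
    (fun s hs => by
      rw [norm_mul]
      exact mul_le_mul_of_nonneg_right (hK s (Set.Ico_subset_Icc_self hs)) (norm_nonneg _))
    b (Set.right_mem_Icc.2 hb)
  exact sub_eq_zero.1 hzero

end Riccati

section Flow

variable {β : (Fin 2 → ℝ) → Fin 2 → ℝ} {κ g : ℝ}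

lemma isParallelFlow_iff (hβ : ∀ x, β ![x, 0] = ![κ * x ^ 2, 0]) {I : Set ℝ} {x : ℝ → ℝ} :
    IsParallelFlow β g I x ↔ x 0 = g ∧ ∀ s ∈ I, HasDerivWithinAt x (κ * x s ^ 2) I s := by
  simp only [IsParallelFlow, hβ, hasDerivWithinAt_pi, Fin.forall_fin_two]
  simp [hasDerivWithinAt_const]

lemma isParallelFlow_riccati (hβ : ∀ x, β ![x, 0] = ![κ * x ^ 2, 0]) {I : Set ℝ}
    (hI : ∀ s ∈ I, 0 < 1 - κ * g * s) :
    IsParallelFlow β g I fun s => g / (1 - κ * g * s) :=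
  (isParallelFlow_iff hβ).2
    ⟨by simp, fun s hs => (hasDerivAt_riccati (hI s hs).ne').hasDerivWithinAt⟩

lemma IsParallelFlow.eq_riccati (hβ : ∀ x, β ![x, 0] = ![κ * x ^ 2, 0]) {I : Set ℝ} {x : ℝ → ℝ}
    (hx : IsParallelFlow β g I x) {s : ℝ} (hs : 0 ≤ s) (hsI : Set.Icc 0 s ⊆ I)
    (hpos : 0 < 1 - κ * g * s) : g / (1 - κ * g * s) = x s := by
  obtain ⟨rfl, hderiv⟩ := (isParallelFlow_iff hβ).1 hx
  rw [div_eq_iff hpos.ne']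
  exact (mul_one_sub_eq_of_riccati hs fun t ht => (hderiv t (hsI ht)).mono hsI).symm

lemma tendsto_riccati_atTop (h : κ * g < 0) :
    Tendsto (fun s => g / (1 - κ * g * s)) atTop (𝓝 0) := by
  refine Tendsto.const_div_atTop ?_ g
  simp only [sub_eq_add_neg, ← neg_mul]
  exact tendsto_atTop_add_const_left _ _ (tendsto_id.const_mul_atTop (by linarith))

lemma one_sub_mul_pos {c s : ℝ} (hc : 0 < c) (hs : s < c⁻¹) : 0 < 1 - c * s := by
  rwa [sub_pos, ← lt_inv_mul_iff₀ hc, mul_one]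

lemma tendsto_riccati_pole (hg : 0 < g) (h : 0 < κ * g) :
    Tendsto (fun s => g / (1 - κ * g * s)) (𝓝[<] (κ * g)⁻¹) atTop := by
  simp only [div_eq_mul_inv]
  refine Tendsto.const_mul_atTop hg (tendsto_inv_nhdsGT_zero.comp ?_)
  refine tendsto_nhdsWithin_iff.2 ⟨?_, ?_⟩
  · have hcont : Continuous fun s : ℝ => 1 - κ * g * s := by fun_prop
    have hlim := hcont.tendsto (κ * g)⁻¹
    rw [mul_inv_cancel₀ h.ne', sub_self] at hlim
    exact hlim.mono_left nhdsWithin_le_nhds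
  · filter_upwards [self_mem_nhdsWithin] with s hs using one_sub_mul_pos h hs

lemma asymptoticallyFree_of_neg (hκ : κ < 0) (hβ : ∀ x, β ![x, 0] = ![κ * x ^ 2, 0]) :
    AsymptoticallyFree β := by
  intro g hg
  have hκg : κ * g < 0 := mul_neg_of_neg_of_pos hκ hg
  have hpos (s : ℝ) (hs : 0 ≤ s) : 0 < 1 - κ * g * s := by
    linarith [mul_nonpos_of_nonpos_of_nonneg hκg.le hs]
  refine ⟨⟨_, isParallelFlow_riccati hβ hpos⟩, fun x hx => ?_⟩
  refine (tendsto_riccati_atTop hκg).congr' ?_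
  filter_upwards [eventually_ge_atTop 0] with s hs
  exact hx.eq_riccati hβ hs Set.Icc_subset_Ici_self (hpos s hs)

lemma hasLandauGhost_of_pos (hκ : 0 < κ) (hβ : ∀ x, β ![x, 0] = ![κ * x ^ 2, 0]) :
    HasLandauGhost β := by
  intro g hg
  have hκg : 0 < κ * g := mul_pos hκ hg
  refine ⟨(κ * g)⁻¹, inv_pos.2 hκg,
    ⟨_, isParallelFlow_riccati hβ fun s hs => one_sub_mul_pos hκg hs.2⟩, fun x hx => ?_⟩
  refine (tendsto_riccati_pole hg hκg).congr' ?_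
  filter_upwards [Ioo_mem_nhdsLT (inv_pos.2 hκg)] with s hs
  exact hx.eq_riccati hβ hs.1.le (fun t ht => ⟨ht.1, ht.2.trans_lt hs.2⟩)
    (one_sub_mul_pos hκg hs.2)

end Flow

end ColorGW

end

theorem theorem1 (μ N : ℝ) :
    (∀ Λ : ℕ,
      ColorGW.EqModCubic (ColorGW.lambdaR μ N Λ 0)
        (MvPowerSeries.X 0 -
          (MvPowerSeries.C (1 - N) * MvPowerSeries.X 0 ^ 2 + MvPowerSeries.X 1 ^ 2) *
            MvPowerSeries.C (ColorGW.S1 μ Λ)) ∧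
      ColorGW.EqModCubic (ColorGW.lambdaR μ N Λ 1)
        (MvPowerSeries.X 1 +
          (2 * MvPowerSeries.X 1 ^ 2 -
              2 * MvPowerSeries.C (1 - N) * MvPowerSeries.X 0 * MvPowerSeries.X 1) *
            MvPowerSeries.C (ColorGW.S1 μ Λ)) ∧
      ColorGW.betaParallel μ N Λ = 1 - N ∧
      ColorGW.betaCrossed μ N Λ = -2 ∧
      (1 < N → ColorGW.AsymptoticallyFree (ColorGW.betaFunction μ N Λ)) ∧
      (N < 1 → ColorGW.HasLandauGhost (ColorGW.betaFunction μ N Λ)) ∧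
      ((∀ x : ℝ, ColorGW.betaFunction μ N Λ ![x, 0] = 0) ↔ N = 1)) ∧
    Tendsto (fun Λ : ℕ => ColorGW.S1 μ Λ) atTop atTop ∧
    (fun Λ : ℕ => ColorGW.S1 μ Λ - Real.log (Λ : ℝ)) =O[atTop] (fun _ => (1 : ℝ)) := by
  refine ⟨fun Λ => ⟨?_, ?_, ColorGW.betaParallel_eq μ N Λ, ColorGW.betaCrossed_eq μ N Λ,
    fun h => ColorGW.asymptoticallyFree_of_neg (sub_neg.2 h) (ColorGW.betaFunction_parallel μ N Λ),
    fun h => ColorGW.hasLandauGhost_of_pos (sub_pos.2 h) (ColorGW.betaFunction_parallel μ N Λ),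
    ColorGW.betaFunction_parallel_eq_zero_iff μ N Λ⟩, ColorGW.tendsto_S1 μ,
    ColorGW.S1_sub_log_isBigO μ⟩
  · convert ColorGW.eqModCubic_lambdaR_zero μ N Λ using 1
    simp only [ColorGW.linearSeries, ColorGW.quadraticSeries, map_neg, map_mul, map_sub, map_one,
      map_zero]
    ring
  · convert ColorGW.eqModCubic_lambdaR_one μ N Λ using 1
    simp only [ColorGW.linearSeries, ColorGW.quadraticSeries, map_neg, map_mul, map_sub, map_one,
      map_zero, map_ofNat]
    ring
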